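/- For a finite undirected graph $G$ and $S\subseteq V_G$ let $G[S]$ be the induced subgraph, let $\mathrm{den}(G)=|E_G|/|V_G|$ be the density of $G$, let $E_{=k}(G)=\max_{S\subseteq V_G,\,|S|=k}|E_{G[S]}|$ and $\mathrm{den}_{\ge k}(G)=\max_{S\subseteq V_G,\,|S|\ge k}\mathrm{den}(G[S])$. For $\lambda\ge 1$, the problem $\mathrm{GapD}k\mathrm{S}(\lambda)$ is: given a graph $G$ and $k,\ell\in\mathbb N$ with $k\le |V_G|$, distinguish between $E_{=k}(G)\ge \ell$ and $E_{=k}(G)<\ell/\lambda$. In Densest At-Least-$k$-Subgraph (DAL$k$S) one is given a graph $G$ and $1\le k\le |V_G|$; an algorithm approximates it to within a factor of $\rho$ if it always outputs a set $S\subseteq V_G$ with $|S|\ge k$ and $\mathrm{den}_{\ge k}(G)\le\rho\cdot\mathrm{den}(G[S])$. **Theorem 1.** Suppose that, for every $\lambda\ge 1$, no polynomial-time algorithm solves $\mathrm{GapD}k\mathrm{S}(\lambda)$. Then, for every $\varepsilon>0$, no polynomial-time algorithm approximates DAL$k$S to within a factor of $3/2-\varepsilon$. Moreover, if for every $\lambda\ge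 1$ and every $f:\mathbb N\to\mathbb N$ no $f(k)\cdot n^{O(1)}$-time algorithm solves $\mathrm{GapD}k\mathrm{S}(\lambda)$, then, for every $\varepsilon>0$ and every $f:\mathbb N\to\mathbb N$, no $f(k)\cdot n^{O(1)}$-time algorithm approximates DAL$k$S to within a factor of $3/2-\varepsilon$. Here $n$ is the length of the input. -/

import Mathlib

noncomputable section

/-! ### Densities and numbers of edges of induced subgraphs -/

/-- The number of edges of the graph `G`. -/
def numEdges {V : Type} (G : SimpleGraph V) : ℕ := G.edgeSet.ncard

/-- The density of a finite graph: the number of edges divided by the number of vertices. -/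
def graphDensity {V : Type} (G : SimpleGraph V) : ℝ := (numEdges G : ℝ) / (Nat.card V : ℝ)

/-- The maximum number of edges of an induced subgraph of `G` on exactly `k` vertices
(used for `k` at most the number of vertices). -/
def maxEdgesEq {V : Type} [Fintype V] (G : SimpleGraph V) (k : ℕ) : ℕ :=
  ((Finset.univ : Finset V).powersetCard k).sup fun S => numEdges (G.induce (S : Set V))

/-- The maximum density of an induced subgraph of `G` on at least `k` vertices
(used for `k` at least one and at most the number of vertices, so that this is a maximum of
a nonempty finite set of densities of nonempty graphs). -/
def maxDensityGe {V : Type} (G : SimpleGraph V) (k : ℕ) : ℝ :=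
  ⨆ S : {S : Finset V // k ≤ S.card}, graphDensity (G.induce ((S : Finset V) : Set V))

/-! ### Computational problems and their running time

The machine model is the multi-stack Turing machine `Turing.FinTM2` of Mathlib (equivalent to
multi-tape Turing machines up to a constant factor in time). Input words are over the alphabet
`Option Bool`, where `none` is a separator; output words are over `Bool`. -/

/-- A parameterized computational problem: instances with their encoding as words, the
parameter of an instance, and the output words that are acceptable on an instance. -/
structure CompProblem where
  /-- the instances -/
  Inst : Type
  /-- the input word that represents an instance -/
  encode : Inst → List (Option Bool)
  /-- the parameter of an instance -/
  param : Inst → ℕ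
  /-- the output words that are acceptable on an instance -/
  Accepts : Inst → List Bool → Prop

/-- The length of the input word of an instance. -/
def CompProblem.size (P : CompProblem) (x : P.Inst) : ℕ := (P.encode x).length

/-- Some Turing machine halts on every instance `x` after at most `T x` steps and with an
acceptable output word. -/
def CompProblem.SolvableInTime (P : CompProblem) (T : P.Inst → ℕ) : Prop :=
  ∃ M : Turing.TM2ComputableAux (Option Bool) Bool, ∀ x : P.Inst, ∃ w : List Bool,
    P.Accepts x w ∧
      Nonempty (Turing.TM2OutputsInTime M.tm ((P.encode x).map M.inputAlphabet.symm)
        (some (w.map M.outputAlphabet.symm)) (T x))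

/-- Some polynomial time algorithm solves the problem. -/
def CompProblem.PolyTimeSolvable (P : CompProblem) : Prop :=
  ∃ p : Polynomial ℕ, P.SolvableInTime fun x => p.eval (P.size x)

/-- Some algorithm with running time `f(k) * n ^ O(1)` solves the problem, where `k` is the
parameter and `n` is the input length. -/
def CompProblem.FPTSolvable (P : CompProblem) (f : ℕ → ℕ) : Prop :=
  ∃ p : Polynomial ℕ, P.SolvableInTime fun x => f (P.param x) * p.eval (P.size x)

/-! ### Encodings -/

/-- A number, in binary (least significant bit first), followed by a separator. -/
def encodeNumber (m : ℕ) : List (Option Bool) :=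
  (Computability.encodeNat m).map some ++ [none]

open Classical in
/-- The adjacency matrix of a graph, row by row, each row followed by a separator. -/
def encodeGraph {n : ℕ} (G : SimpleGraph (Fin n)) : List (Option Bool) :=
  (List.finRange n).flatMap fun u =>
    (List.finRange n).map (fun v => some (decide (G.Adj u v))) ++ [none]

/-- A set of vertices as its characteristic vector. -/
def encodeVertexSet {n : ℕ} (S : Finset (Fin n)) : List Bool :=
  (List.finRange n).map fun v => decide (v ∈ S)

/-! ### The gap version of Densest `k`-Subgraph -/

/-- An instance: a graph `G` and numbers `k`, `l`, where `G` has at least `k` vertices. -/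
structure DkSInstance where
  /-- the number of vertices -/
  n : ℕ
  /-- the graph -/
  G : SimpleGraph (Fin n)
  /-- the number of vertices of the subgraphs in question -/
  k : ℕ
  /-- the number of edges in question -/
  l : ℕ
  /-- there are subgraphs on `k` vertices -/
  k_le : k ≤ n

/-- The problem of distinguishing between graphs with at least `l` edges on some `k` vertices
and graphs with fewer than `l / lam` edges on any `k` vertices. On every instance the answer
has to be a single bit; on instances of neither kind it may be any bit. -/
def GapDkS (lam : ℝ) : CompProblem where
  Inst := DkSInstance
  encode x := encodeNumber x.k ++ encodeNumber x.l ++ encodeGraph x.G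
  param x := x.k
  Accepts x w := ∃ b : Bool, w = [b] ∧
    (x.l ≤ maxEdgesEq x.G x.k → b = true) ∧
    ((maxEdgesEq x.G x.k : ℝ) < (x.l : ℝ) / lam → b = false)

/-! ### Densest At-Least-`k`-Subgraph -/

/-- An instance: a graph `G` and a positive number `k` that is at most the number of
vertices. -/
structure DALkSInstance where
  /-- the number of vertices -/
  n : ℕ
  /-- the graph -/
  G : SimpleGraph (Fin n)
  /-- the least number of vertices of the subgraphs in question -/
  k : ℕ
  /-- the subgraphs in question are nonempty -/
  k_pos : 1 ≤ k
  /-- there are subgraphs on at least `k` vertices -/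
  k_le : k ≤ n

/-- The problem of approximating Densest At-Least-`k`-Subgraph to within a factor `rho`: find a
set of at least `k` vertices such that the maximum density of a subgraph on at least `k`
vertices is at most `rho` times the density of the subgraph induced on the set. -/
def ApproxDALkS (rho : ℝ) : CompProblem where
  Inst := DALkSInstance
  encode x := encodeNumber x.k ++ encodeGraph x.G
  param x := x.k
  Accepts x w := ∃ S : Finset (Fin x.n), w = encodeVertexSet S ∧ x.k ≤ S.card ∧
    maxDensityGe x.G x.k ≤ rho * graphDensity (x.G.induce (S : Set (Fin x.n)))

end

/-! The gap problem is reduced to DAL$k$S with one query. Fix a large integer `r` and put `m = 2 * r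
^ 2 * k * l`. The new graph has `l` layers, each a copy of the vertex set of $G$; `r ^ 2 * k` copies
of every ordered pair `(a, b)`, joined, if `ab` is an edge, to the copies of `a` and `b` in every
layer; and a separate complete bipartite graph with sides `2 * l * r` and `l * r * k`, which has `l
* m` edges on only $O(m/r)$ vertices. Dense subgraphs on at least `m` vertices are sought.

If some `k` vertices of $G$ span `l` edges, their copies in all layers, the copies of the `2 * l`
ordered adjacent pairs (`m` vertices with `2 * l` neighbours each) and the bipartite graph make up
$(1+O(1/r))m$ vertices with $3lm$ edges, so the density is nearly $3l$ (`exists_dense_set`). In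
general a pair gains a second edge into a layer only if both of its endpoints are there. Thus, on
average, much more than one edge per pair and layer requires a layer of at most `2 * r ^ 4 * k`
vertices that contains many edges of $G$, or many larger layers. The latter force more than about
$rm$ vertices, and then the bipartite graph hardly contributes. So without a small layer rich in
edges the density is at most $(2+2/r)l$ (`exists_dense_layer`).

The quotient of the two densities tends to $3/2$. Hence an answer within a smaller factor exhibits a
layer of $O_r(k)$ vertices with at least $l/r$ ordered adjacent pairs, and cutting it into blocks of
$k/2$ vertices gives `k` vertices of $G$ with at least $l/(72r^9)$ edges
(`GoodLayer.le_maxEdgesEq`). Looking for such a layer therefore solves the gap problem for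
$\lambda=72r^9$ (`verdict_eq_true`, `verdict_eq_false`). Since only instances with $2l\le k^2$
matter, `m` is bounded in terms of `k`, which gives the parameterized statement as well.

That all this takes polynomial time on a Turing machine is shown with a small language of stack
programs, simulated step by step (`Prog.Run.stepsTo`). The functions that they compute in polynomial
time (`Comp`) are closed under concatenation, local definitions, loops over words, comparison and
conversion to binary. `outputsInTime_callComputable` joins the two programs of the reduction to the
machine that answers the query. -/

noncomputable section

open Turing

/-! ### A structured language of stack programs -/

/-- Programs over stacks that are numbered by natural numbers and hold symbols of `Option Bool`. -/
inductive Prog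
  | skip
  | push (i : ℕ) (s : Option Bool)
  | seq (P Q : Prog)
  | case (i : ℕ) (Z : Prog) (P : Option Bool → Prog)
  | loop (i : ℕ) (P : Option Bool → Prog)

/-- The contents of all stacks. -/
abbrev Store := ℕ → List (Option Bool)

namespace Prog

/-- `P.Run st t st'`: started on the stacks `st`, the program `P` makes `t` steps and ends
with the stacks `st'`. -/
inductive Run : Prog → Store → ℕ → Store → Prop
  | skip (st : Store) : Run skip st 1 st
  | push (i : ℕ) (s : Option Bool) (st : Store) :
      Run (push i s) st 1 (Function.update st i (s :: st i))
  | seq {P Q : Prog} {a b c : Store} {t u : ℕ} :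
      Run P a t b → Run Q b u c → Run (seq P Q) a (t + u) c
  | case_nil {i : ℕ} {Z : Prog} {P : Option Bool → Prog} {a b : Store} {t : ℕ} :
      a i = [] → Run Z a t b → Run (case i Z P) a (t + 1) b
  | case_cons {i : ℕ} {Z : Prog} {P : Option Bool → Prog} {a b : Store} {t : ℕ}
      {s : Option Bool} {l : List (Option Bool)} :
      a i = s :: l → Run (P s) (Function.update a i l) t b → Run (case i Z P) a (t + 1) b
  | loop_nil {i : ℕ} {P : Option Bool → Prog} {a : Store} :
      a i = [] → Run (loop i P) a 1 a
  | loop_cons {i : ℕ} {P : Option Bool → Prog} {a b c : Store} {t u : ℕ}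
      {s : Option Bool} {l : List (Option Bool)} :
      a i = s :: l → Run (P s) (Function.update a i l) t b → Run (loop i P) b u c →
      Run (loop i P) a (1 + t + u) c

/-- A bound on the indices of the stacks that a program uses. -/
def bound : Prog → ℕ
  | skip => 0
  | push i _ => i
  | seq P Q => max P.bound Q.bound
  | case i Z P => max i (max Z.bound (Finset.univ.sup fun s => (P s).bound))
  | loop i P => max i (Finset.univ.sup fun s => (P s).bound)

/-- The labels of the machine that executes a program. -/
def Lab : Prog → Type
  | skip => Unit
  | push _ _ => Unit
  | seq P Q => P.Lab ⊕ Q.Lab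
  | case _ Z P => Option (Z.Lab ⊕ Σ s, (P s).Lab)
  | loop _ P => Option (Σ s, (P s).Lab)

instance instFintypeLab : (P : Prog) → Fintype P.Lab
  | skip => inferInstanceAs (Fintype Unit)
  | push _ _ => inferInstanceAs (Fintype Unit)
  | seq P Q =>
    letI := instFintypeLab P
    letI := instFintypeLab Q
    inferInstanceAs (Fintype (P.Lab ⊕ Q.Lab))
  | case _ Z P =>
    letI := instFintypeLab Z
    letI := fun s => instFintypeLab (P s)
    inferInstanceAs (Fintype (Option (Z.Lab ⊕ Σ s, (P s).Lab)))
  | loop _ P =>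
    letI := fun s => instFintypeLab (P s)
    inferInstanceAs (Fintype (Option (Σ s, (P s).Lab)))

/-- The label at which the execution of a program starts. -/
def entry : (P : Prog) → P.Lab
  | skip => ()
  | push _ _ => ()
  | seq P _ => Sum.inl P.entry
  | case _ _ _ => none
  | loop _ _ => none

section Machine

variable {K : Type} (Γ : K → Type) (σ : Type) (B : ℕ)

/-- The alphabets of a machine with `B + 1` stacks for a program and the stacks `K`. -/
@[reducible] def JoinΓ : Fin (B + 1) ⊕ K → Type
  | Sum.inl _ => Option Bool
  | Sum.inr k => Γ k

/-- The contents of all stacks of the machine. -/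
def joinStk {Γ : K → Type} {B : ℕ} (st : Store) (u : ∀ k, List (Γ k)) :
    ∀ k, List (JoinΓ Γ B k)
  | Sum.inl i => st i
  | Sum.inr k => u k

variable {Γ σ}

/-- The statement at a label of a program; `emb` places the labels and `exit` is the label
at which the execution ends. -/
def code {L : Type} : (P : Prog) → (emb : P.Lab → L) → (exit : L) → P.Lab →
    TM2.Stmt (JoinΓ Γ B) L (σ × Option (Option Bool))
  | skip, _, exit, _ => TM2.Stmt.goto fun _ => exit
  | push i s, _, exit, _ =>
    TM2.Stmt.push (Sum.inl (Fin.ofNat (B + 1) i)) (fun _ => s) (TM2.Stmt.goto fun _ => exit)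
  | seq P _, emb, _, Sum.inl l => code P (fun l => emb (Sum.inl l)) (emb (Sum.inr (entry _))) l
  | seq _ Q, emb, exit, Sum.inr l => code Q (fun l => emb (Sum.inr l)) exit l
  | case i Z P, emb, _, none =>
    TM2.Stmt.pop (Sum.inl (Fin.ofNat (B + 1) i)) (fun v s => (v.1, s)) (TM2.Stmt.goto fun v =>
      match v.2 with
      | none => emb (some (Sum.inl Z.entry))
      | some s => emb (some (Sum.inr ⟨s, (P s).entry⟩)))
  | case _ Z _, emb, exit, some (Sum.inl l) => code Z (fun l => emb (some (Sum.inl l))) exit l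
  | case _ _ P, emb, exit, some (Sum.inr ⟨s, l⟩) =>
    code (P s) (fun l => emb (some (Sum.inr ⟨s, l⟩))) exit l
  | loop i P, emb, exit, none =>
    TM2.Stmt.pop (Sum.inl (Fin.ofNat (B + 1) i)) (fun v s => (v.1, s)) (TM2.Stmt.goto fun v =>
      match v.2 with
      | none => exit
      | some s => emb (some ⟨s, (P s).entry⟩))
  | loop _ P, emb, _, some ⟨s, l⟩ =>
    code (P s) (fun l => emb (some ⟨s, l⟩)) (emb none) l

end Machine

end Prog

/-! ### Simulation of stack programs by multi-stack machines. -/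

open Prog in
theorem joinStk_inl {K : Type} {Γ : K → Type} {B : ℕ} (st : Store) (u : ∀ k, List (Γ k)) {i : ℕ} (hi : i ≤ B) :
    joinStk (B := B) st u (Sum.inl (Fin.ofNat (B + 1) i)) = st i := by
  simp [joinStk, Fin.ofNat, Nat.mod_eq_of_lt (Nat.lt_succ_of_le hi)]

section Machine
variable {K : Type} [DecidableEq K] {Γ : K → Type} {σ : Type} {B : ℕ}

open Prog

theorem update_joinStk_inl (st : Store) (u : ∀ k, List (Γ k)) {i : ℕ} (hi : i ≤ B)
    (x : List (Option Bool)) :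
    Function.update (joinStk (B := B) st u) (Sum.inl (Fin.ofNat (B + 1) i)) x =
      joinStk (Function.update st i x) u := by
  funext k
  rcases k with j | k
  · by_cases h : j = Fin.ofNat (B + 1) i
    · subst h
      have : ((Fin.ofNat (B + 1) i : Fin (B + 1)) : ℕ) = i := by
        simp [Fin.ofNat, Nat.mod_eq_of_lt (Nat.lt_succ_of_le hi)]
      simp [joinStk, Fin.ofNat, Nat.mod_eq_of_lt (Nat.lt_succ_of_le hi)]
    · have h' : (j : ℕ) ≠ i := by
        rintro rfl
        exact h (by ext; simp [Fin.ofNat, Nat.mod_eq_of_lt j.2])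
      rw [Function.update_of_ne (by simpa using h)]
      simp [joinStk, h']
  · rw [Function.update_of_ne (by simp)]
    rfl

theorem update_joinStk_inr (st : Store) (u : ∀ k, List (Γ k)) (k : K) (x : List (Γ k)) :
    Function.update (joinStk (B := B) st u) (Sum.inr k) x =
      joinStk st (Function.update u k x) := by
  funext k'
  rcases k' with j | k'
  · rw [Function.update_of_ne (by simp)]
    rfl
  · by_cases h : k' = k
    · subst h
      simp [joinStk]
    · rw [Function.update_of_ne (by simpa using h)]
      simp [joinStk, h]

/-- `t` steps of the machine `m` lead from `a` to `b`. -/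
def StepsTo {K : Type} [DecidableEq K] {Γ : K → Type} {L σ : Type}
    (m : L → TM2.Stmt Γ L σ) (t : ℕ) (a b : TM2.Cfg Γ L σ) : Prop :=
  (flip bind (TM2.step m))^[t] (some a) = some b

theorem StepsTo.trans {K : Type} [DecidableEq K] {Γ : K → Type} {L σ : Type}
    {m : L → TM2.Stmt Γ L σ} {t u : ℕ} {a b c : TM2.Cfg Γ L σ}
    (h₁ : StepsTo m t a b) (h₂ : StepsTo m u b c) : StepsTo m (t + u) a c := by
  unfold StepsTo at *
  rw [add_comm, Function.iterate_add_apply, h₁, h₂]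

theorem StepsTo.one {K : Type} [DecidableEq K] {Γ : K → Type} {L σ : Type}
    {m : L → TM2.Stmt Γ L σ} {a b : TM2.Cfg Γ L σ}
    (h : TM2.step m a = some b) : StepsTo m 1 a b := h

/-- Induction on the run. The machine and the placement of the labels are arbitrary so that the
hypothesis applies to subprograms inside the machine of a larger program. Only the scratch component
of the state, which holds the symbol popped last, may change. -/
theorem Prog.Run.stepsTo {P : Prog} {st st' : Store} {t : ℕ} (h : P.Run st t st') :
    ∀ {L : Type} (m : L → TM2.Stmt (JoinΓ Γ B) L (σ × Option (Option Bool)))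
      (emb : P.Lab → L) (exit : L), P.bound ≤ B → (∀ l, m (emb l) = P.code B emb exit l) →
      ∀ (u : ∀ k, List (Γ k)) (v : σ) (x : Option (Option Bool)), ∃ x',
        StepsTo m t ⟨some (emb P.entry), (v, x), joinStk st u⟩
          ⟨some exit, (v, x'), joinStk st' u⟩ := by
  induction h with
  | skip st =>
    intro L m emb exit hB hm u v x
    refine ⟨x, StepsTo.one ?_⟩
    simp only [TM2.step, hm]
    rfl
  | push i s st =>
    intro L m emb exit hB hm u v x
    refine ⟨x, StepsTo.one ?_⟩
    have hB : i ≤ B := hB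
    simp only [TM2.step, hm]
    simp only [code, TM2.stepAux]
    rw [joinStk_inl _ _ hB, update_joinStk_inl _ _ hB]
  | @seq P Q a b c t t' h₁ h₂ ih₁ ih₂ =>
    intro L m emb exit hB hm u v x
    have hB : max P.bound Q.bound ≤ B := hB
    obtain ⟨x₁, e₁⟩ := ih₁ m (fun l => emb (Sum.inl l)) (emb (Sum.inr Q.entry)) (by omega)
      (fun l => hm (Sum.inl l)) u v x
    obtain ⟨x₂, e₂⟩ := ih₂ m (fun l => emb (Sum.inr l)) exit (by omega)
      (fun l => hm (Sum.inr l)) u v x₁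
    exact ⟨x₂, e₁.trans e₂⟩
  | @case_nil i Z P a b t h₁ h₂ ih =>
    intro L m emb exit hB hm u v x
    have hB : max i (max Z.bound (Finset.univ.sup fun s => (P s).bound)) ≤ B := hB
    obtain ⟨x₂, e₂⟩ := ih m (fun l => emb (some (Sum.inl l))) exit (by omega)
      (fun l => hm (some (Sum.inl l))) u v none
    refine ⟨x₂, ?_⟩
    rw [add_comm t 1]
    refine StepsTo.trans (StepsTo.one ?_) e₂
    have hi : i ≤ B := by omega
    simp only [TM2.step, hm]
    simp only [code, TM2.stepAux, entry]
    have hu : Function.update a i [] = a := by rw [← h₁, Function.update_eq_self]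
    rw [joinStk_inl _ _ hi, update_joinStk_inl _ _ hi, h₁]
    simp [hu]
  | @case_cons i Z P a b t s l h₁ h₂ ih =>
    intro L m emb exit hB hm u v x
    have hB : max i (max Z.bound (Finset.univ.sup fun s => (P s).bound)) ≤ B := hB
    have hs : (P s).bound ≤ Finset.univ.sup fun s => (P s).bound :=
      Finset.le_sup (f := fun s => (P s).bound) (Finset.mem_univ s)
    obtain ⟨x₂, e₂⟩ := ih m (fun l => emb (some (Sum.inr ⟨s, l⟩))) exit (by omega)
      (fun l => hm (some (Sum.inr ⟨s, l⟩))) u v (some s)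
    refine ⟨x₂, ?_⟩
    rw [add_comm t 1]
    refine StepsTo.trans (StepsTo.one ?_) e₂
    have hi : i ≤ B := by omega
    simp only [TM2.step, hm]
    simp only [code, TM2.stepAux, entry]
    rw [joinStk_inl _ _ hi, update_joinStk_inl _ _ hi, h₁]
    simp
  | @loop_nil i P a h₁ =>
    intro L m emb exit hB hm u v x
    have hB : max i (Finset.univ.sup fun s => (P s).bound) ≤ B := hB
    refine ⟨none, StepsTo.one ?_⟩
    have hi : i ≤ B := by omega
    simp only [TM2.step, hm]
    simp only [code, TM2.stepAux, entry]
    have hu : Function.update a i [] = a := by rw [← h₁, Function.update_eq_self]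
    rw [joinStk_inl _ _ hi, update_joinStk_inl _ _ hi, h₁]
    simp [hu]
  | @loop_cons i P a b c t t' s l h₁ h₂ h₃ ih₂ ih₃ =>
    intro L m emb exit hB hm u v x
    have hB' : max i (Finset.univ.sup fun s => (P s).bound) ≤ B := hB
    have hs : (P s).bound ≤ Finset.univ.sup fun s => (P s).bound :=
      Finset.le_sup (f := fun s => (P s).bound) (Finset.mem_univ s)
    obtain ⟨x₂, e₂⟩ := ih₂ m (fun l => emb (some ⟨s, l⟩)) (emb none) (by omega)
      (fun l => hm (some ⟨s, l⟩)) u v (some s)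
    obtain ⟨x₃, e₃⟩ := ih₃ m emb exit hB hm u v x₂
    refine ⟨x₃, StepsTo.trans (StepsTo.trans (StepsTo.one ?_) e₂) e₃⟩
    have hi : i ≤ B := by omega
    simp only [TM2.step, hm]
    simp only [code, TM2.stepAux, entry]
    rw [joinStk_inl _ _ hi, update_joinStk_inl _ _ hi, h₁]
    simp

/-! ### Embedding a machine -/

/-- A statement of a machine as a statement of a larger machine, which goes to `exit` instead
of halting. -/
def liftStmt {Λ L : Type} (emb : Λ → L) (exit : L) :
    TM2.Stmt Γ Λ σ → TM2.Stmt (JoinΓ Γ B) L (σ × Option (Option Bool))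
  | .push k f q => .push (Sum.inr k) (fun v => f v.1) (liftStmt emb exit q)
  | .peek k f q => .peek (Sum.inr k) (fun v s => (f v.1 s, v.2)) (liftStmt emb exit q)
  | .pop k f q => .pop (Sum.inr k) (fun v s => (f v.1 s, v.2)) (liftStmt emb exit q)
  | .load f q => .load (fun v => (f v.1, v.2)) (liftStmt emb exit q)
  | .branch f p q => .branch (fun v => f v.1) (liftStmt emb exit p) (liftStmt emb exit q)
  | .goto f => .goto fun v => emb (f v.1)
  | .halt => .goto fun _ => exit

/-- A configuration of a machine as a configuration of a larger machine. -/
def liftCfg {Λ L : Type} (emb : Λ → L) (exit : L) (st : Store) (x : Option (Option Bool))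
    (c : TM2.Cfg Γ Λ σ) : TM2.Cfg (JoinΓ Γ B) L (σ × Option (Option Bool)) :=
  ⟨some (c.l.elim exit emb), (c.var, x), joinStk st c.stk⟩

theorem stepAux_liftStmt {Λ L : Type} (emb : Λ → L) (exit : L) (st : Store)
    (x : Option (Option Bool)) (q : TM2.Stmt Γ Λ σ) : ∀ (v : σ) (u : ∀ k, List (Γ k)),
    TM2.stepAux (liftStmt (B := B) emb exit q) (v, x) (joinStk st u) =
      liftCfg emb exit st x (TM2.stepAux q v u) := by
  induction q with
  | push k f q ih =>
    intro v u
    simp only [liftStmt, TM2.stepAux, update_joinStk_inr, ih]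
    rfl
  | peek k f q ih =>
    intro v u
    simp only [liftStmt, TM2.stepAux, ih]
    rfl
  | pop k f q ih =>
    intro v u
    simp only [liftStmt, TM2.stepAux, update_joinStk_inr, ih]
    rfl
  | load f q ih =>
    intro v u
    simp only [liftStmt, TM2.stepAux, ih]
  | branch f p q ihp ihq =>
    intro v u
    simp only [liftStmt, TM2.stepAux]
    cases f v <;> simp [ihp, ihq]
  | goto f =>
    intro v u
    rfl
  | halt =>
    intro v u
    rfl

/-- The lifted machine jumps to `exit` in the very step in which the original one halts, so the
numbers of steps agree. -/
theorem StepsTo.lift {Λ L : Type} {m : Λ → TM2.Stmt Γ Λ σ}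
    {m' : L → TM2.Stmt (JoinΓ Γ B) L (σ × Option (Option Bool))} {emb : Λ → L} {exit : L}
    (hm : ∀ l, m' (emb l) = liftStmt emb exit (m l)) (st : Store) (x : Option (Option Bool))
    {t : ℕ} : ∀ {a b : TM2.Cfg Γ Λ σ}, StepsTo m t a b →
    StepsTo m' t (liftCfg emb exit st x a) (liftCfg emb exit st x b) := by
  induction t with
  | zero =>
    intro a b h
    simp only [StepsTo, Function.iterate_zero, id, Option.some.injEq] at h ⊢
    rw [h]
  | succ t ih =>
    intro a b h
    rcases ha : a.l with _ | l
    -- A halted configuration has no successor, so no run of positive length starts there.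
    · exfalso
      have hs : TM2.step m a = none := by
        rcases a with ⟨l, v, u⟩
        simp only at ha
        subst ha
        rfl
      have : ∀ t, (flip bind (TM2.step m))^[t] (none : Option (TM2.Cfg Γ Λ σ)) = none := by
        intro t
        induction t with
        | zero => rfl
        | succ t ih => rw [Function.iterate_succ_apply]; exact ih
      unfold StepsTo at h
      rw [Function.iterate_succ_apply] at h
      have h2 : flip bind (TM2.step m) (some a) = none := hs
      rw [h2, this] at h
      cases h
    · rcases a with ⟨l', v, u⟩
      simp only at ha
      subst ha
      have h1 : StepsTo m t (TM2.stepAux (m l) v u) b := by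
        unfold StepsTo at h ⊢
        rw [Function.iterate_succ_apply] at h
        exact h
      rw [add_comm t 1]
      refine StepsTo.trans (StepsTo.one ?_) (ih h1)
      rw [← stepAux_liftStmt, ← hm]
      rfl

end Machine

/-! ### A machine that calls another machine once. -/

section CallMachine
open Prog

/-- The labels of the machine that executes `P₁`, then a machine with labels `Λ`, then `P₂`. -/
abbrev CallLab (P₁ P₂ : Prog) (Λ : Type) : Type := (P₁.Lab ⊕ P₂.Lab) ⊕ (Λ ⊕ Fin 3)

/-- The statements of the machine that executes `P₁`, moves the contents of stack `1` to the
input stack of `M`, executes `M`, moves the output back to stack `1`, executes `P₂` and outputs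
the top symbol of stack `2`. -/
def callStmt (M : TM2ComputableAux (Option Bool) Bool) (P₁ P₂ : Prog) (B : ℕ) :
    CallLab P₁ P₂ M.tm.Λ →
      TM2.Stmt (JoinΓ M.tm.Γ B) (CallLab P₁ P₂ M.tm.Λ) (M.tm.σ × Option (Option Bool))
  | Sum.inl (Sum.inl l) =>
    P₁.code B (fun l => Sum.inl (Sum.inl l)) (Sum.inr (Sum.inr 0)) l
  | Sum.inl (Sum.inr l) =>
    P₂.code B (fun l => Sum.inl (Sum.inr l)) (Sum.inr (Sum.inr 2)) l
  | Sum.inr (Sum.inl l) =>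
    liftStmt (fun l => Sum.inr (Sum.inl l)) (Sum.inr (Sum.inr 1)) (M.tm.m l)
  | Sum.inr (Sum.inr 0) =>
    .pop (Sum.inl (Fin.ofNat (B + 1) 1)) (fun v s => (v.1, s)) <|
      .branch (fun v => v.2.isSome)
        (.push (Sum.inr M.tm.k₀) (fun v => M.inputAlphabet.symm (v.2.getD none)) <|
          .goto fun _ => Sum.inr (Sum.inr 0))
        (.goto fun _ => Sum.inr (Sum.inl M.tm.main))
  | Sum.inr (Sum.inr 1) =>
    .pop (Sum.inr M.tm.k₁) (fun v s => (v.1, s.map fun s => some (M.outputAlphabet s))) <|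
      .branch (fun v => v.2.isSome)
        (.push (Sum.inl (Fin.ofNat (B + 1) 1)) (fun v => v.2.getD none) <|
          .goto fun _ => Sum.inr (Sum.inr 1))
        (.goto fun _ => Sum.inl (Sum.inr P₂.entry))
  | Sum.inr (Sum.inr 2) =>
    .pop (Sum.inl (Fin.ofNat (B + 1) 2)) (fun v s => (v.1, s)) <|
      .push (Sum.inr M.tm.k₁)
        (fun v => M.outputAlphabet.symm (decide (v.2 = some (some true)))) <|
        .load (fun v => (v.1, none)) .halt

/-- The machine that executes `P₁`, then `M`, then `P₂`. -/
def callMachine (M : TM2ComputableAux (Option Bool) Bool) (P₁ P₂ : Prog) (B : ℕ) : FinTM2 :=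
  letI := M.tm.kFin
  letI := M.tm.ΛFin
  letI := M.tm.σFin
  { K := Fin (B + 1) ⊕ M.tm.K
    k₀ := Sum.inl 0
    k₁ := Sum.inr M.tm.k₁
    Γ := JoinΓ M.tm.Γ B
    Λ := CallLab P₁ P₂ M.tm.Λ
    main := Sum.inl (Sum.inl P₁.entry)
    σ := M.tm.σ × Option (Option Bool)
    initialState := (M.tm.initialState, none)
    Γk₀Fin := inferInstanceAs (Fintype (Option Bool))
    m := callStmt M P₁ P₂ B }

/-- The machine `callMachine` with its alphabets. -/
def callComputable (M : TM2ComputableAux (Option Bool) Bool) (P₁ P₂ : Prog) (B : ℕ) :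
    TM2ComputableAux (Option Bool) Bool where
  tm := callMachine M P₁ P₂ B
  inputAlphabet := Equiv.refl (Option Bool)
  outputAlphabet := M.outputAlphabet

variable {M : TM2ComputableAux (Option Bool) Bool} {P₁ P₂ : Prog} {B : ℕ}

theorem initList_eq (tm : FinTM2) (s : List (tm.Γ tm.k₀)) :
    initList tm s = ⟨some tm.main, tm.initialState, Function.update (fun _ => []) tm.k₀ s⟩ := by
  unfold initList
  congr 1
  funext k
  by_cases h : k = tm.k₀
  · subst h
    simp
  · simp [h]

theorem haltList_eq (tm : FinTM2) (s : List (tm.Γ tm.k₁)) :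
    haltList tm s = ⟨none, tm.initialState, Function.update (fun _ => []) tm.k₁ s⟩ := by
  unfold haltList
  congr 1
  funext k
  by_cases h : k = tm.k₁
  · subst h
    simp
  · simp [h]

/-- Moving a word from one stack to another reverses it; this is why the first program has to leave
the query reversed, and why the second program finds the answer reversed. -/
theorem stepsTo_copyIn (hB : 1 ≤ B) (v : M.tm.σ) (st : Store) : ∀ (l : List (Option Bool))
    (r : List (M.tm.Γ M.tm.k₀)) (x : Option (Option Bool)), ∃ x',
    StepsTo (callStmt M P₁ P₂ B) (l.length + 1)
      ⟨some (Sum.inr (Sum.inr 0)), (v, x),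
        joinStk (Function.update st 1 l) (Function.update (fun _ => []) M.tm.k₀ r)⟩
      ⟨some (Sum.inr (Sum.inl M.tm.main)), (v, x'),
        joinStk (Function.update st 1 [])
          (Function.update (fun _ => []) M.tm.k₀
            ((l.map M.inputAlphabet.symm).reverse ++ r))⟩ := by
  intro l
  induction l with
  | nil =>
    intro r x
    refine ⟨none, StepsTo.one ?_⟩
    simp only [TM2.step, callStmt, TM2.stepAux]
    rw [joinStk_inl _ _ hB, update_joinStk_inl _ _ hB]
    simp
  | cons s l ih =>
    intro r x
    obtain ⟨x', h⟩ := ih (M.inputAlphabet.symm s :: r) (some s)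
    refine ⟨x', ?_⟩
    rw [List.length_cons, add_comm (l.length + 1) 1]
    refine StepsTo.trans (StepsTo.one ?_) (by simpa using h)
    simp only [TM2.step, callStmt, TM2.stepAux]
    rw [joinStk_inl _ _ hB, update_joinStk_inl _ _ hB, update_joinStk_inr]
    simp [joinStk]

theorem stepsTo_copyOut (hB : 1 ≤ B) (v : M.tm.σ) (st : Store) : ∀ (l : List Bool)
    (r : List (Option Bool)) (x : Option (Option Bool)), ∃ x',
    StepsTo (callStmt M P₁ P₂ B) (l.length + 1)
      ⟨some (Sum.inr (Sum.inr 1)), (v, x),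
        joinStk (Function.update st 1 r)
          (Function.update (fun _ => []) M.tm.k₁ (l.map M.outputAlphabet.symm))⟩
      ⟨some (Sum.inl (Sum.inr P₂.entry)), (v, x'),
        joinStk (Function.update st 1 ((l.map some).reverse ++ r)) (fun _ => [])⟩ := by
  intro l
  induction l with
  | nil =>
    intro r x
    refine ⟨none, StepsTo.one ?_⟩
    simp only [TM2.step, callStmt, TM2.stepAux]
    rw [update_joinStk_inr]
    simp [joinStk]
  | cons s l ih =>
    intro r x
    obtain ⟨x', h⟩ := ih (some s :: r) (some (some s))
    refine ⟨x', ?_⟩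
    rw [List.length_cons, add_comm (l.length + 1) 1]
    refine StepsTo.trans (StepsTo.one ?_) (by simpa using h)
    simp only [TM2.step, callStmt, TM2.stepAux]
    rw [update_joinStk_inr, joinStk_inl _ _ hB, update_joinStk_inl _ _ hB]
    simp [joinStk]

/-- The five phases are concatenated. The constant 3 counts the two pops from an empty stack that
end the copying loops and the final output step. A halting configuration has nothing but the output
on its stacks, so the second program must clear everything except stack `2`. -/
theorem outputsInTime_callComputable (hB : 2 ≤ B) (h₁ : P₁.bound ≤ B) (h₂ : P₂.bound ≤ B)
    {inp query : List (Option Bool)} {w : List Bool} {b : Bool} {t₁ T t₂ : ℕ} {st : Store}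
    (r₁ : P₁.Run (Function.update (fun _ => []) 0 inp) t₁
      (Function.update st 1 query.reverse))
    (hM : Nonempty (TM2OutputsInTime M.tm (query.map M.inputAlphabet.symm)
      (some (w.map M.outputAlphabet.symm)) T))
    (r₂ : P₂.Run (Function.update st 1 (w.map some).reverse) t₂
      (Function.update (fun _ => []) 2 [some b])) :
    Nonempty (TM2OutputsInTime (callComputable M P₁ P₂ B).tm
      (inp.map (callComputable M P₁ P₂ B).inputAlphabet.symm)
      (some ([b].map (callComputable M P₁ P₂ B).outputAlphabet.symm))
      (t₁ + query.length + T + w.length + t₂ + 3)) := by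
  obtain ⟨⟨⟨n, hn⟩, hle⟩⟩ := hM
  have hM' : StepsTo M.tm.m n (initList M.tm (query.map M.inputAlphabet.symm))
    (haltList M.tm (w.map M.outputAlphabet.symm)) := hn
  rw [initList_eq, haltList_eq] at hM'
  obtain ⟨x₁, e₁⟩ := r₁.stepsTo (B := B) (callStmt M P₁ P₂ B) (fun l => Sum.inl (Sum.inl l))
    (Sum.inr (Sum.inr 0)) h₁ (fun l => rfl) (fun _ => []) M.tm.initialState none
  obtain ⟨x₂, e₂⟩ := stepsTo_copyIn (M := M) (P₁ := P₁) (P₂ := P₂) (B := B) (by omega)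
    M.tm.initialState st query.reverse [] x₁
  have e₃ := hM'.lift (B := B) (m' := callStmt M P₁ P₂ B) (emb := fun l => Sum.inr (Sum.inl l))
    (exit := Sum.inr (Sum.inr 1)) (fun l => rfl) (Function.update st 1 []) x₂
  obtain ⟨x₄, e₄⟩ := stepsTo_copyOut (M := M) (P₁ := P₁) (P₂ := P₂) (B := B) (by omega)
    M.tm.initialState st w [] x₂
  obtain ⟨x₅, e₅⟩ := r₂.stepsTo (B := B) (callStmt M P₁ P₂ B) (fun l => Sum.inl (Sum.inr l))
    (Sum.inr (Sum.inr 2)) h₂ (fun l => rfl) (fun _ => []) M.tm.initialState x₄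
  -- The output step also resets the scratch symbol, because `haltList` demands the initial state.
  have e₆ : StepsTo (callStmt M P₁ P₂ B) 1
      ⟨some (Sum.inr (Sum.inr 2)), (M.tm.initialState, x₅),
        joinStk (Function.update (fun _ => []) 2 [some b]) (fun _ => [])⟩
      ⟨none, (M.tm.initialState, none),
        joinStk (fun _ => []) (Function.update (fun _ => []) M.tm.k₁
          [M.outputAlphabet.symm b])⟩ := by
    refine StepsTo.one ?_
    simp only [TM2.step, callStmt, TM2.stepAux]
    rw [joinStk_inl _ _ hB, update_joinStk_inl _ _ hB, update_joinStk_inr]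
    simp [joinStk]
  simp only [List.map_reverse, List.reverse_reverse, List.append_nil, List.length_reverse,
    Function.update_eq_self] at e₂ e₄
  have e := ((((e₁.trans e₂).trans e₃).trans e₄).trans e₅).trans e₆
  have h₀ : (fun _ => [] : ∀ k, List (JoinΓ M.tm.Γ B k)) = joinStk (fun _ => []) (fun _ => []) := by
    funext k
    rcases k with k | k <;> rfl
  have hi : initList (callMachine M P₁ P₂ B)
      (inp.map (callComputable M P₁ P₂ B).inputAlphabet.symm) =
      ⟨some (Sum.inl (Sum.inl P₁.entry)), (M.tm.initialState, none),
        joinStk (Function.update (fun _ => []) 0 inp) fun _ => []⟩ := by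
    refine Eq.trans (congrArg (initList (callMachine M P₁ P₂ B)) (List.map_id inp)) ?_
    refine Eq.trans (initList_eq _ _) ?_
    rw [← update_joinStk_inl _ _ (Nat.zero_le B), ← h₀]
    rfl
  have ho : haltList (callMachine M P₁ P₂ B)
      ([b].map (callComputable M P₁ P₂ B).outputAlphabet.symm) =
      ⟨none, (M.tm.initialState, none),
        joinStk (fun _ => []) (Function.update (fun _ => []) M.tm.k₁
          [M.outputAlphabet.symm b])⟩ := by
    rw [haltList_eq, ← update_joinStk_inr, ← h₀]
    rfl
  have h : StepsTo (callStmt M P₁ P₂ B) (t₁ + (query.length + 1) + n + (w.length + 1) + t₂ + 1)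
      (initList (callMachine M P₁ P₂ B)
        (inp.map (callComputable M P₁ P₂ B).inputAlphabet.symm))
      (haltList (callMachine M P₁ P₂ B)
        ([b].map (callComputable M P₁ P₂ B).outputAlphabet.symm)) :=
    (congrArg₂ (StepsTo (callStmt M P₁ P₂ B) _) hi ho).mpr e
  have hle : n ≤ T := hle
  exact ⟨⟨⟨_, h⟩, show _ + _ ≤ _ by omega⟩⟩

end CallMachine

/-! ### Functions computed by programs in polynomial time -/

theorem Polynomial.eval_le_eval_nat (p : Polynomial ℕ) {a b : ℕ} (h : a ≤ b) :
    p.eval a ≤ p.eval b := by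
  rw [Polynomial.eval_eq_sum_range, Polynomial.eval_eq_sum_range]
  exact Finset.sum_le_sum fun i _ => Nat.mul_le_mul_left _ (Nat.pow_le_pow_left h i)

namespace Prog

theorem run_move {i j : ℕ} (hij : i ≠ j) : ∀ (l : List (Option Bool)) (st : Store), st i = l →
    (loop i fun s => push j s).Run st (2 * l.length + 1)
      (Function.update (Function.update st i []) j (l.reverse ++ st j)) := by
  intro l
  induction l with
  | nil =>
    intro st h
    have e : Function.update (Function.update st i []) j (List.reverse [] ++ st j) = st := by
      funext k
      simp only [Function.update_apply]
      split_ifs <;> simp_all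
    rw [e]
    exact Run.loop_nil h
  | cons s l ih =>
    intro st h
    have r := Run.loop_cons (P := fun s => push j s) h (Run.push j s _) (ih _ (by simp [hij]))
    convert r using 1
    · simp only [List.length_cons]; ring
    · funext k
      simp only [Function.update_apply]
      split_ifs <;> simp_all

theorem run_copy {i j k : ℕ} (hij : i ≠ j) (hik : i ≠ k) (hjk : j ≠ k) :
    ∀ (l : List (Option Bool)) (st : Store), st i = l →
    (loop i fun s => seq (push j s) (push k s)).Run st (3 * l.length + 1)
      (Function.update (Function.update (Function.update st i []) j (l.reverse ++ st j)) k
        (l.reverse ++ st k)) := by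
  intro l
  induction l with
  | nil =>
    intro st h
    have e : Function.update (Function.update (Function.update st i []) j (List.reverse [] ++ st j))
        k (List.reverse [] ++ st k) = st := by
      funext k
      simp only [Function.update_apply]
      split_ifs <;> simp_all
    rw [e]
    exact Run.loop_nil h
  | cons s l ih =>
    intro st h
    have r := Run.loop_cons (P := fun s => seq (push j s) (push k s)) h
      ((Run.push j s _).seq (Run.push k s _)) (ih _ (by simp [hij, hik]))
    convert r using 1
    · simp only [List.length_cons]; ring
    · clear * - hij hik hjk
      funext m
      by_cases k1 : m = i
      · subst k1; simp [hij, hik]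
      by_cases k2 : m = k
      · subst k2; simp [hik.symm, hjk.symm]
      by_cases k3 : m = j
      · subst k3; simp [hij.symm, k2]
      simp [k1, k2, k3]

theorem run_clear {i : ℕ} : ∀ (l : List (Option Bool)) (st : Store), st i = l →
    (loop i fun _ => skip).Run st (2 * l.length + 1) (Function.update st i []) := by
  intro l
  induction l with
  | nil =>
    intro st h
    have e : Function.update st i [] = st := by rw [← h, Function.update_eq_self]
    rw [e]
    exact Run.loop_nil h
  | cons s l ih =>
    intro st h
    have r := Run.loop_cons (P := fun _ => skip) h (Run.skip _) (ih _ (by simp))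
    convert r using 1
    · simp only [List.length_cons]; ring
    · simp

theorem run_pushes (o : ℕ) (w : List (Option Bool)) (st : Store) :
    (w.foldr (fun s P => seq (push o s) P) skip).Run st (w.length + 1)
      (Function.update st o (w.reverse ++ st o)) := by
  induction w generalizing st with
  | nil => simpa using Run.skip st
  | cons s w ih =>
    have h := (Run.push o s st).seq (ih (Function.update st o (s :: st o)))
    simp only [List.foldr_cons, List.length_cons]
    rw [add_comm (w.length + 1) 1]
    convert h using 1
    simp

theorem update_restore {st : Store} {o c : ℕ} (h : o ≠ c) (hc : st c = [])
    (x y : List (Option Bool)) :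
    Function.update (Function.update (Function.update st c x) o y) c [] =
      Function.update st o y := by
  rw [Function.update_comm h, Function.update_idem, ← hc, Function.update_eq_self]

theorem Run.exists_le {P : Prog} {a b b' : Store} {t T : ℕ} (r : P.Run a t b) (hb : b = b')
    (ht : t ≤ T) : ∃ u ≤ T, P.Run a u b' :=
  ⟨t, ht, hb ▸ r⟩

end Prog

open Prog

/-- `Comp V F`: some program computes `F γ` from stacks with the contents `v γ`, `v ∈ V`, in
polynomial time in the lengths of these stacks. The program reads `v` from the stack `loc v`,
which it leaves unchanged, pushes the result on the stack `o`, and uses stacks from number `b`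
on for intermediate results. -/
def Comp {Γ : Type} (V : Set (Γ → List (Option Bool))) (F : Γ → List (Option Bool)) : Prop :=
  ∃ (P : ((Γ → List (Option Bool)) → ℕ) → ℕ → ℕ → Prog) (p : Polynomial ℕ),
    (∀ γ N, (∀ v ∈ V, (v γ).length ≤ N) → (F γ).length ≤ p.eval N) ∧
    ∀ loc o b γ (st : Store) N,
      (∀ v ∈ V, loc v < b ∧ loc v ≠ o ∧ st (loc v) = v γ ∧ (v γ).length ≤ N) → o < b →
      (∀ i, b ≤ i → st i = []) →
      ∃ t ≤ p.eval N, (P loc o b).Run st t (Function.update st o ((F γ).reverse ++ st o))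

/-- The concatenation of the words `f s pre` for all symbols `s` of a word, where `pre` is the
reverse of the part of the word before `s` (preceded by a given word). -/
def bindPrefix (f : Option Bool → List (Option Bool) → List (Option Bool)) :
    List (Option Bool) → List (Option Bool) → List (Option Bool)
  | _, [] => []
  | pre, s :: l => f s pre ++ bindPrefix f (s :: pre) l

/-! ### Closure properties of polynomial-time computable functions. -/

namespace Comp

variable {Γ Γ' : Type} {V : Set (Γ → List (Option Bool))} {V' : Set (Γ' → List (Option Bool))}
  {F G : Γ → List (Option Bool)}

theorem const (w : List (Option Bool)) : Comp V fun _ => w := by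
  refine ⟨fun _ o _ => w.foldr (fun s P => seq (push o s) P) skip,
    Polynomial.C (w.length + 1), fun γ N _ => by simp, fun loc o b γ st N _ _ _ =>
      ⟨w.length + 1, by simp, run_pushes o w st⟩⟩

/-- Results lie reversed on the output stack, so that concatenation is just execution in sequence.
-/
theorem append (hF : Comp V F) (hG : Comp V G) : Comp V fun γ => F γ ++ G γ := by
  obtain ⟨P, p, hp, hP⟩ := hF
  obtain ⟨Q, q, hq, hQ⟩ := hG
  refine ⟨fun loc o b => seq (P loc o b) (Q loc o b), p + q, fun γ N h => ?_,
    fun loc o b γ st N h ho hb => ?_⟩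
  · rw [List.length_append, Polynomial.eval_add]
    exact add_le_add (hp γ N h) (hq γ N h)
  · obtain ⟨t, ht, r⟩ := hP loc o b γ st N h ho hb
    obtain ⟨u, hu, r'⟩ := hQ loc o b γ (Function.update st o ((F γ).reverse ++ st o)) N
      (fun v hv => by
        obtain ⟨h₁, h₂, h₃, h₄⟩ := h v hv
        exact ⟨h₁, h₂, by rw [Function.update_of_ne h₂, h₃], h₄⟩) ho
      (fun i hi => by rw [Function.update_of_ne (by omega), hb i hi])
    refine ⟨t + u, by rw [Polynomial.eval_add]; exact add_le_add ht hu, ?_⟩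
    convert r.seq r' using 1
    simp

/-- Reading a stack empties it; the word is therefore copied to the output and to a scratch stack,
from which it is restored. -/
theorem var {v : Γ → List (Option Bool)} (hv : v ∈ V) : Comp V v := by
  refine ⟨fun loc o b => seq (loop (loc v) fun s => seq (push b s) (push o s))
    (loop b fun s => push (loc v) s), 5 * Polynomial.X + 2, fun γ N h => ?_,
    fun loc o b γ st N h ho hb => ?_⟩
  · have := h v hv
    simp
    omega
  · obtain ⟨h₁, h₂, h₃, h₄⟩ := h v hv
    have h5 : o ≠ b := by omega
    have h6 : loc v ≠ b := by omega
    have h7 := hb b le_rfl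
    have r := (run_copy h6 h₂ h5.symm (v γ) st h₃).seq
      (run_move (i := b) (j := loc v) h6.symm ((v γ).reverse ++ st b) _
        (by rw [Function.update_of_ne h5.symm, Function.update_self]))
    refine r.exists_le ?_ ?_
    · clear * - h₂ h₃ h5 h6 h7
      funext k
      by_cases k1 : k = loc v
      · subst k1; simp [h₂, h6, h7, h₃]
      by_cases k2 : k = b
      · subst k2; simp [h5.symm, k1, h7]
      by_cases k3 : k = o
      · subst k3; simp [k1, k2]
      simp [k1, k2, k3]
    · simp [h7]
      omega

/-- A change of context only renames the stacks from which the variables are read. -/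
theorem comap (g : Γ' → Γ) (hg : ∀ v ∈ V, v ∘ g ∈ V') (hF : Comp V F) :
    Comp V' fun γ => F (g γ) := by
  obtain ⟨P, p, hp, hP⟩ := hF
  refine ⟨fun loc o b => P (fun v => loc (v ∘ g)) o b, p, fun γ N h => ?_,
    fun loc o b γ st N h ho hb => ?_⟩
  · exact hp (g γ) N fun v hv => h _ (hg v hv)
  · exact hP _ o b (g γ) st N (fun v hv => h _ (hg v hv)) ho hb

theorem reverse (hF : Comp V F) : Comp V fun γ => (F γ).reverse := by
  obtain ⟨P, p, hp, hP⟩ := hF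
  refine ⟨fun loc o b => seq (P loc b (b + 1)) (loop b fun s => push o s), 3 * p + 1,
    fun γ N h => ?_, fun loc o b γ st N h ho hb => ?_⟩
  · have := hp γ N h
    simp
    omega
  · obtain ⟨t, ht, r⟩ := hP loc b (b + 1) γ st N (fun v hv => by
      obtain ⟨h₁, h₂, h₃, h₄⟩ := h v hv
      exact ⟨by omega, by omega, h₃, h₄⟩) (by omega) (fun i hi => hb i (by omega))
    have r' := run_move (i := b) (j := o) (by omega) _ _ (Function.update_self b
      ((F γ).reverse ++ st b) st)
    have := hp γ N fun v hv => (h v hv).2.2.2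
    have h7 := hb b le_rfl
    refine (r.seq r').exists_le ?_ ?_
    · have h5 : o ≠ b := by omega
      simp only [h7, List.append_nil, List.reverse_reverse, Function.update_idem]
      rw [Function.update_of_ne h5, ← h7, Function.update_eq_self]
    · simp [h7]
      omega

open Classical in
-- The value of `F` arises reversed on stack `b`; moving it to `b + 1` puts it in the right order
-- for use as a variable.
theorem letVar (hF : Comp V F) (hG : Comp (insert F V) G) : Comp V G := by
  obtain ⟨P, p, hp, hP⟩ := hF
  obtain ⟨Q, q, hq, hQ⟩ := hG
  refine ⟨fun loc o b => seq (P loc b (b + 2)) (seq (loop b fun s => push (b + 1) s)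
    (seq (Q (Function.update loc F (b + 1)) o (b + 2)) (loop (b + 1) fun _ => skip))),
    5 * p + 2 + q.comp (p + Polynomial.X), fun γ N h => ?_, fun loc o b γ st N h ho hb => ?_⟩
  · have h1 := hp γ N h
    have h2 := hq γ (p.eval N + N) (by
      rintro v (rfl | hv)
      · omega
      · have := h v hv; omega)
    simp
    omega
  · have hl := hp γ N fun v hv => (h v hv).2.2.2
    obtain ⟨t, ht, r⟩ := hP loc b (b + 2) γ st N (fun v hv => by
      obtain ⟨h₁, h₂, h₃, h₄⟩ := h v hv
      exact ⟨by omega, by omega, h₃, h₄⟩) (by omega) (fun i hi => hb i (by omega))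
    have r' := run_move (i := b) (j := b + 1) (by omega) _ _ (Function.update_self b
      ((F γ).reverse ++ st b) st)
    have h7 := hb b le_rfl
    have h8 := hb (b + 1) (by omega)
    have e : Function.update (Function.update (Function.update st b ((F γ).reverse ++ st b)) b [])
        (b + 1) (((F γ).reverse ++ st b).reverse ++
          Function.update st b ((F γ).reverse ++ st b) (b + 1)) =
        Function.update st (b + 1) (F γ) := by
      simp only [Function.update_idem, h7, List.append_nil, List.reverse_reverse]
      rw [Function.update_of_ne (by omega), h8, List.append_nil]
      rw [show Function.update st b [] = st by rw [← h7, Function.update_eq_self]]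
    rw [e] at r'
    obtain ⟨u, hu, s⟩ := hQ (Function.update loc F (b + 1)) o (b + 2) γ
      (Function.update st (b + 1) (F γ)) (p.eval N + N) (by
        intro v hv
        by_cases hvF : v = F
        · subst hvF
          simp only [Function.update_self]
          exact ⟨by omega, by omega, trivial, by omega⟩
        · have hv' : v ∈ V := hv.resolve_left hvF
          obtain ⟨h₁, h₂, h₃, h₄⟩ := h v hv'
          rw [Function.update_of_ne hvF]
          exact ⟨by omega, h₂, by rw [Function.update_of_ne (by omega), h₃], by omega⟩)
      (by omega) (fun i hi => by rw [Function.update_of_ne (by omega)]; exact hb i (by omega))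
    have s' := run_clear (i := b + 1) _ _ (rfl : (Function.update (Function.update st (b + 1) (F γ)) o
      ((G γ).reverse ++ Function.update st (b + 1) (F γ) o)) (b + 1) = _)
    refine (r.seq (r'.seq (s.seq s'))).exists_le ?_ ?_
    · have h5 : o ≠ b + 1 := by omega
      rw [Function.update_of_ne h5]
      exact update_restore h5 h8 _ _
    · rw [Function.update_of_ne (by omega), Function.update_self]
      simp [h7]
      omega

/-- The variables in a context that has been extended by a word. -/
def extWord (V : Set (Γ → List (Option Bool))) : Set (Γ × List (Option Bool) → List (Option Bool)) :=
  insert Prod.snd ((fun v => v ∘ Prod.fst) '' V)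

open Classical in
-- The basic loop. The symbols of the word are taken from stack `b` and collected on `b + 1`, where
-- the body can read the part already processed; its length serves as a loop counter. The body never
-- sees words longer than a polynomial bound, so the total time is polynomial.
theorem forEach (hF : Comp V F) {f : Option Bool → Γ × List (Option Bool) → List (Option Bool)}
    (hf : ∀ s, Comp (extWord V) (f s)) :
    Comp V fun γ => bindPrefix (fun s pre => f s (γ, pre)) [] (F γ) := by
  obtain ⟨P, p, hp, hP⟩ := hF
  choose Q q hq hQ using hf
  -- Different `w` may give the same `v`, and `Prod.snd` might be among the `w ∘ Prod.fst`. Any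
  -- choice will do, since only the value on the chosen stack matters.
  let loc' (loc : (Γ → List (Option Bool)) → ℕ) (b : ℕ) :
      (Γ × List (Option Bool) → List (Option Bool)) → ℕ := fun v =>
    if h : ∃ w ∈ V, v = w ∘ Prod.fst then loc h.choose else b + 1
  let body (loc : (Γ → List (Option Bool)) → ℕ) (o b : ℕ) (s : Option Bool) : Prog :=
    seq (Q s (loc' loc b) o (b + 2)) (push (b + 1) s)
  -- One bound for the bodies of all symbols: a prefix has length at most `p.eval N`, any other
  -- variable at most `N`.
  let T : Polynomial ℕ := (∑ s, q s).comp (p + Polynomial.X)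
  have hT : ∀ s N, (q s).eval (p.eval N + N) ≤ T.eval N := by
    intro s N
    simp only [T, Polynomial.eval_comp, Polynomial.eval_finsetSum, Polynomial.eval_add,
      Polynomial.eval_X]
    exact Finset.single_le_sum (f := fun s => (q s).eval (p.eval N + N)) (fun _ _ => Nat.zero_le _)
      (Finset.mem_univ s)
  refine ⟨fun loc o b => seq (P loc (b + 1) (b + 2)) (seq (loop (b + 1) fun s => push b s)
    (seq (loop b (body loc o b)) (loop (b + 1) fun _ => skip))), 5 * p + 3 + p * (T + 2),
    fun γ N h => ?_, fun loc o b γ st N h ho hb => ?_⟩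
  · have h1 := hp γ N h
    have h2 : ∀ (l pre : List (Option Bool)), pre.length + l.length ≤ p.eval N →
        (bindPrefix (fun s pre => f s (γ, pre)) pre l).length ≤ l.length * T.eval N := by
      intro l
      induction l with
      | nil => intro pre _; simp [bindPrefix]
      | cons s l ih =>
        intro pre hpre
        simp only [List.length_cons] at hpre
        have h3 := ih (s :: pre) (by simp only [List.length_cons]; omega)
        have h4 := hq s (γ, pre) (p.eval N + N) (by
          rintro v (rfl | ⟨w, hw, rfl⟩)
          · show pre.length ≤ _
            omega
          · have := h w hw
            show (w γ).length ≤ _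
            omega)
        have h5 := hT s N
        simp only [bindPrefix, List.length_append, List.length_cons, Nat.succ_mul]
        omega
    have h3 := h2 (F γ) [] (by simpa using h1)
    have h4 : (F γ).length * T.eval N ≤ p.eval N * T.eval N := Nat.mul_le_mul_right _ h1
    simp only [Polynomial.eval_add, Polynomial.eval_mul, Polynomial.eval_ofNat]
    rw [mul_add]
    omega
  · have hl := hp γ N fun v hv => (h v hv).2.2.2
    obtain ⟨t, ht, r⟩ := hP loc (b + 1) (b + 2) γ st N (fun v hv => by
      obtain ⟨h₁, h₂, h₃, h₄⟩ := h v hv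
      exact ⟨by omega, by omega, h₃, h₄⟩) (by omega) (fun i hi => hb i (by omega))
    have r' := run_move (i := b + 1) (j := b) (by omega) _ _ (Function.update_self (b + 1)
      ((F γ).reverse ++ st (b + 1)) st)
    have h7 := hb b le_rfl
    have h8 := hb (b + 1) (by omega)
    have h5 : o ≠ b := by omega
    have h6 : o ≠ b + 1 := by omega
    let S (x l pre : List (Option Bool)) : Store :=
      Function.update (Function.update (Function.update st o x) b l) (b + 1) pre
    have key : ∀ (l pre x : List (Option Bool)), pre.length + l.length ≤ p.eval N →
        ∃ u ≤ l.length * (T.eval N + 2) + 1, (loop b (body loc o b)).Run (S x l pre) u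
          (S ((bindPrefix (fun s pre => f s (γ, pre)) pre l).reverse ++ x) []
            (l.reverse ++ pre)) := by
      intro l
      induction l with
      | nil =>
        intro pre x _
        exact ⟨1, by simp, Run.loop_nil (by simp [S])⟩
      | cons s l ih =>
        intro pre x hpre
        simp only [List.length_cons] at hpre
        obtain ⟨u, hu, h3⟩ := ih (s :: pre) ((f s (γ, pre)).reverse ++ x)
          (by simp only [List.length_cons]; omega)
        obtain ⟨u', hu', h4⟩ := hQ s (loc' loc b) o (b + 2) (γ, pre) (S x l pre) (p.eval N + N)
          (by
            intro v hv
            by_cases hw : ∃ w ∈ V, v = w ∘ Prod.fst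
            · obtain ⟨hw₁, hw₂⟩ := hw.choose_spec
              obtain ⟨h₁, h₂, h₃, h₄⟩ := h _ hw₁
              have hv' : v (γ, pre) = hw.choose γ := by
                conv_lhs => rw [hw₂]
                rfl
              simp only [loc', dif_pos hw]
              refine ⟨by omega, h₂, ?_, ?_⟩
              · simp only [S]
                rw [Function.update_of_ne (by omega), Function.update_of_ne (by omega),
                  Function.update_of_ne h₂, h₃, hv']
              · rw [hv']; omega
            · have hv' : v = Prod.snd := by
                rcases hv with rfl | ⟨w, hw', rfl⟩
                · rfl
                · exact absurd ⟨w, hw', rfl⟩ hw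
              simp only [loc', dif_neg hw]
              subst hv'
              refine ⟨by omega, by omega, by simp [S], ?_⟩
              show pre.length ≤ _
              omega) (by omega)
          (fun i hi => by
            simp only [S]
            rw [Function.update_of_ne (by omega), Function.update_of_ne (by omega),
              Function.update_of_ne (by omega), hb i (by omega)])
        have h9 := hT s N
        have e1 : Function.update (S x (s :: l) pre) b l = S x l pre := by
          simp only [S]
          rw [Function.update_comm (by omega), Function.update_idem]
        have e2 : ∀ st' : Store, st' = Function.update (S x l pre) o
            ((f s (γ, pre)).reverse ++ S x l pre o) →
            Function.update st' (b + 1) (s :: st' (b + 1)) =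
              S ((f s (γ, pre)).reverse ++ x) l (s :: pre) := by
          rintro _ rfl
          clear * - h5 h6
          funext k
          by_cases k1 : k = b + 1
          · subst k1; simp [S, h6.symm]
          by_cases k2 : k = b
          · subst k2; simp [S, h5.symm]
          by_cases k3 : k = o
          · subst k3; simp [S, h5, h6]
          simp [S, k1, k2, k3]
        have h10 := Run.push (b + 1) s (Function.update (S x l pre) o
            ((f s (γ, pre)).reverse ++ S x l pre o))
        rw [e2 _ rfl] at h10
        have h11 := Run.loop_cons (i := b) (P := body loc o b) (a := S x (s :: l) pre)
          (s := s) (l := l) (by simp [S]) (by rw [e1]; exact h4.seq h10) h3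
        refine (h11).exists_le ?_ ?_
        · simp [bindPrefix]
        · simp only [List.length_cons, Nat.succ_mul]
          omega
    obtain ⟨u, hu, r''⟩ := key (F γ) [] (st o) (by simpa using hl)
    have e : Function.update (Function.update (Function.update st (b + 1)
        ((F γ).reverse ++ st (b + 1))) (b + 1) []) b
        (((F γ).reverse ++ st (b + 1)).reverse ++
          Function.update st (b + 1) ((F γ).reverse ++ st (b + 1)) b) =
        S (st o) (F γ) [] := by
      clear * - h5 h6 h7 h8
      funext k
      by_cases k1 : k = b + 1
      · subst k1; simp [S]
      by_cases k2 : k = b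
      · subst k2; simp [S, h7, h8]
      by_cases k3 : k = o
      · subst k3; simp [S, h5, h6]
      simp [S, k1, k2]
    rw [e] at r'
    have s' := run_clear (i := b + 1) _ _ (rfl : S ((bindPrefix (fun s pre => f s (γ, pre)) []
      (F γ)).reverse ++ st o) [] ((F γ).reverse ++ []) (b + 1) = _)
    refine (r.seq (r'.seq (r''.seq s'))).exists_le ?_ ?_
    · clear * - h5 h6 h7 h8
      funext k
      by_cases k1 : k = b + 1
      · subst k1; simp [S, h6.symm, h8]
      by_cases k2 : k = b
      · subst k2; simp [S, h5.symm, h7]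
      by_cases k3 : k = o
      · subst k3; simp [S, h5, h6]
      simp [S, k1, k2, k3]
    · have h4 : (F γ).length * (T.eval N + 2) ≤ p.eval N * (T.eval N + 2) :=
        Nat.mul_le_mul_right _ hl
      simp [h8, S]
      omega

end Comp

/-! ### Comparison of words and conversion to binary -/

namespace Prog

/-- Compares the words on the stacks `i` and `j` symbol by symbol; every mismatch puts a mark on
stack `k`. -/
def compareLoop (i j k : ℕ) : Prog :=
  loop i fun s => case j (push k none) fun s' => if s = s' then skip else push k none

/-- A second word that is too short produces marks, one that is too long leaves a remainder on `j`;
so equality means no marks and no remainder. -/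
theorem run_compareLoop {i j k : ℕ} (hij : i ≠ j) (hik : i ≠ k) (hjk : j ≠ k) :
    ∀ (l m : List (Option Bool)) (st : Store), st i = l → st j = m →
    ∃ t ≤ 3 * l.length + 1, ∃ st', (compareLoop i j k).Run st t st' ∧ st' i = [] ∧
      (st' k).length ≤ (st k).length + l.length ∧ (st' j).length ≤ m.length ∧
      (st' k = [] ∧ st' j = [] ↔ st k = [] ∧ l = m) ∧
      ∀ x, x ≠ i → x ≠ j → x ≠ k → st' x = st x := by
  intro l
  induction l with
  | nil =>
    intro m st h h'
    refine ⟨1, by simp, st, Run.loop_nil h, h, by simp, by simp [h'], ?_, fun _ _ _ _ => rfl⟩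
    rw [h', eq_comm (a := m)]
  | cons s l ih =>
    intro m st h h'
    cases m with
    | nil =>
      obtain ⟨t, ht, st', r, h1, h2, h3, h4, h5⟩ := ih []
        (Function.update (Function.update st i l) k (none :: Function.update st i l k))
        (by simp [hik]) (by simp [hjk, hij.symm, h'])
      refine ⟨_, ?_, st', Run.loop_cons h (Run.case_nil (by simp [hij.symm, h']) (Run.push k none _))
        r, h1, ?_, h3, ?_, fun x x1 x2 x3 => ?_⟩
      · simp only [List.length_cons]; omega
      · simp [hik.symm] at h2 ⊢; omega
      · simp [h4]
      · rw [h5 x x1 x2 x3]; simp [x1, x3]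
    | cons s' m =>
      by_cases hs : s = s'
      · obtain ⟨t, ht, st', r, h1, h2, h3, h4, h5⟩ := ih m
          (Function.update (Function.update st i l) j m)
          (by simp [hij]) (by simp)
        refine ⟨_, ?_, st', Run.loop_cons h (Run.case_cons (s := s') (l := m)
          (by simp [hij.symm, h']) (by rw [if_pos hs]; exact Run.skip _))
          r, h1, ?_, ?_, ?_, fun x x1 x2 x3 => ?_⟩
        · simp only [List.length_cons]; omega
        · simp [hik.symm, hjk.symm] at h2 ⊢; omega
        · simp only [List.length_cons]; omega
        · rw [h4]; simp [hik.symm, hjk.symm, hs]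
        · rw [h5 x x1 x2 x3]; simp [x1, x2]
      · obtain ⟨t, ht, st', r, h1, h2, h3, h4, h5⟩ := ih m
          (Function.update (Function.update (Function.update st i l) j m) k
            (none :: Function.update (Function.update st i l) j m k))
          (by simp [hij, hik]) (by simp [hjk])
        refine ⟨_, ?_, st', Run.loop_cons h (Run.case_cons (s := s') (l := m)
          (by simp [hij.symm, h']) (by rw [if_neg hs]; exact Run.push k none _))
          r, h1, ?_, ?_, ?_, fun x x1 x2 x3 => ?_⟩
        · simp only [List.length_cons]; omega
        · simp [hik.symm, hjk.symm] at h2 ⊢; omega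
        · simp only [List.length_cons]; omega
        · rw [h4]; simp [hs]
        · rw [h5 x x1 x2 x3]; simp [x1, x2, x3]

end Prog

/-- The successor of a binary number, with the least significant bit first. -/
def binSucc : List Bool → List Bool
  | [] => [true]
  | false :: l => true :: l
  | true :: l => false :: binSucc l

theorem encodePosNum_succ (n : PosNum) :
    Computability.encodePosNum n.succ = binSucc (Computability.encodePosNum n) := by
  induction n with
  | one => rfl
  | bit1 n ih => simp [PosNum.succ, Computability.encodePosNum, binSucc, ih]
  | bit0 n ih => simp [PosNum.succ, Computability.encodePosNum, binSucc]

theorem encodeNat_zero : Computability.encodeNat 0 = [] := rfl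

theorem encodeNat_succ (n : ℕ) :
    Computability.encodeNat (n + 1) = binSucc (Computability.encodeNat n) := by
  unfold Computability.encodeNat
  rw [Nat.cast_succ, Num.add_one]
  cases (n : Num) with
  | zero => rfl
  | pos p => exact encodePosNum_succ p

theorem length_binSucc_le (l : List Bool) : (binSucc l).length ≤ l.length + 1 := by
  induction l with
  | nil => simp [binSucc]
  | cons b l ih => cases b <;> simp [binSucc]; omega

theorem length_encodeNat_le (n : ℕ) : (Computability.encodeNat n).length ≤ n := by
  induction n with
  | zero => simp [encodeNat_zero]
  | succ n ih =>
    rw [encodeNat_succ]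
    exact (length_binSucc_le _).trans (by omega)

theorem encodeNat_injective : Function.Injective Computability.encodeNat :=
  Function.LeftInverse.injective Computability.decode_encodeNat

namespace Prog

/-- Moves a binary number from stack `i` to stack `j` and adds the carry on stack `k`. -/
def carryLoop (i j k : ℕ) : Prog :=
  loop i fun s => case k (push j s) fun _ =>
    if s = some true then seq (push j (some false)) (push k none) else push j (some true)

/-- The invariant of addition with carry, where a final carry counts as one more most significant
digit. -/
theorem run_carryLoop {i j k : ℕ} (hij : i ≠ j) (hik : i ≠ k) (hjk : j ≠ k) :
    ∀ (l : List Bool) (c : Bool) (st : Store), st i = l.map some →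
    st k = (if c then [none] else []) →
    ∃ t ≤ 4 * l.length + 1, ∃ (st' : Store) (c' : Bool), (carryLoop i j k).Run st t st' ∧ st' i = [] ∧
      st' k = (if c' then [none] else []) ∧
      (if c' then some true :: st' j else st' j) =
        ((if c then binSucc l else l).map some).reverse ++ st j ∧
      ∀ x, x ≠ i → x ≠ j → x ≠ k → st' x = st x := by
  intro l
  induction l with
  | nil =>
    intro c st h h'
    refine ⟨1, by simp, st, c, Run.loop_nil h, h, h', ?_, fun _ _ _ _ => rfl⟩
    cases c <;> simp [binSucc]
  | cons b l ih =>
    intro c st h h'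
    cases c with
    | false =>
      obtain ⟨t, ht, st', c', r, h1, h2, h3, h4⟩ := ih false
        (Function.update (Function.update st i (l.map some)) j
          (some b :: Function.update st i (l.map some) j))
        (by simp [hij]) (by simp [hjk.symm, hik.symm, h'])
      refine ⟨_, ?_, st', c', Run.loop_cons h (Run.case_nil (by simp [hik.symm, h'])
        (Run.push j (some b) _)) r, h1, h2, ?_, fun x x1 x2 x3 => ?_⟩
      · simp only [List.length_cons]; omega
      · rw [h3]; simp [hij.symm]
      · rw [h4 x x1 x2 x3]; simp [x1, x2]
    | true =>
      cases b with
      | false =>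
        obtain ⟨t, ht, st', c', r, h1, h2, h3, h4⟩ := ih false
          (Function.update (Function.update (Function.update st i (l.map some)) k []) j
            (some true :: Function.update (Function.update st i (l.map some)) k [] j))
          (by simp [hij, hik]) (by simp [hjk.symm])
        refine ⟨_, ?_, st', c', Run.loop_cons h (Run.case_cons (s := none) (l := [])
          (by simp [hik.symm, h']) (by rw [if_neg (by simp)]; exact Run.push j (some true) _)) r,
          h1, h2, ?_, fun x x1 x2 x3 => ?_⟩
        · simp only [List.length_cons]; omega
        · rw [h3]; simp [hij.symm, hjk, binSucc]
        · rw [h4 x x1 x2 x3]; simp [x1, x2, x3]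
      | true =>
        obtain ⟨t, ht, st', c', r, h1, h2, h3, h4⟩ := ih true
          (Function.update (Function.update (Function.update (Function.update st i (l.map some)) k [])
            j (some false :: Function.update (Function.update st i (l.map some)) k [] j)) k
            (none :: Function.update (Function.update (Function.update st i (l.map some)) k [])
            j (some false :: Function.update (Function.update st i (l.map some)) k [] j) k))
          (by simp [hij, hik]) (by simp [hjk.symm])
        refine ⟨_, ?_, st', c', Run.loop_cons h (Run.case_cons (s := none) (l := [])
          (by simp [hik.symm, h']) (by
            rw [if_pos rfl]; exact (Run.push j (some false) _).seq (Run.push k none _))) r,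
          h1, h2, ?_, fun x x1 x2 x3 => ?_⟩
        · simp only [List.length_cons]; omega
        · rw [h3]; simp [hij.symm, hjk, binSucc]
        · rw [h4 x x1 x2 x3]; simp [x1, x2, x3]

/-- Adds one to the binary number on stack `i`, with the auxiliary stacks `j` and `k`. -/
def increment (i j k : ℕ) : Prog :=
  seq (push k none) (seq (carryLoop i j k) (seq (case k skip fun _ => push j (some true))
    (loop j fun s => push i s)))

theorem run_increment {i j k : ℕ} (hij : i ≠ j) (hik : i ≠ k) (hjk : j ≠ k) (l : List Bool)
    (st : Store) (hi : st i = l.map some) (hj : st j = []) (hk : st k = []) :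
    ∃ t ≤ 6 * l.length + 7, (increment i j k).Run st t
      (Function.update st i ((binSucc l).map some)) := by
  obtain ⟨t, ht, st', c', r, h1, h2, h3, h4⟩ := run_carryLoop hij hik hjk l true
    (Function.update st k (none :: st k)) (by simp [hik, hi]) (by simp [hk])
  simp only [if_true] at h3
  rw [Function.update_of_ne hjk, hj, List.append_nil] at h3
  have h5 : ∃ st'', (case k skip fun _ => push j (some true)).Run st' 2 st'' ∧
      st'' j = ((binSucc l).map some).reverse ∧ st'' k = [] ∧
      ∀ x, x ≠ j → x ≠ k → st'' x = st' x := by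
    cases c' with
    | false => exact ⟨st', Run.case_nil h2 (Run.skip _), h3, h2, fun _ _ _ => rfl⟩
    | true =>
      refine ⟨_, Run.case_cons (s := none) (l := []) h2 (Run.push j (some true) _), ?_, ?_,
        fun x x1 x2 => ?_⟩
      · rw [← h3]; simp [hjk]
      · simp [hjk.symm]
      · simp [x1, x2]
  obtain ⟨st'', r', h6, h7, h8⟩ := h5
  have r'' := run_move hij.symm _ _ h6
  refine ((Run.push k none st).seq (r.seq (r'.seq r''))).exists_le ?_ ?_
  · have h9 : st'' i = [] := by rw [h8 i hij hik, h1]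
    funext x
    by_cases x1 : x = i
    · subst x1; simp [h9]
    by_cases x2 : x = j
    · subst x2; simp [x1, hj]
    by_cases x3 : x = k
    · subst x3; simp [x1, x2, h7, hk]
    rw [Function.update_of_ne x1, Function.update_of_ne x2, h8 x x2 x3, h4 x x1 x2 x3,
      Function.update_of_ne x3, Function.update_of_ne x1]
  · have := length_binSucc_le l
    simp
    omega

/-- The length of a word is found by repeated increments. Bounding the number of digits by the
number itself is enough for a quadratic time bound. -/
theorem run_count {c i j k : ℕ} (hci : c ≠ i) (hcj : c ≠ j) (hck : c ≠ k) (hij : i ≠ j)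
    (hik : i ≠ k) (hjk : j ≠ k) :
    ∀ (w : List (Option Bool)) (m : ℕ) (st : Store), st c = w →
    st i = (Computability.encodeNat m).map some → st j = [] → st k = [] →
    ∃ t ≤ w.length * (6 * (m + w.length) + 8) + 1,
      (loop c fun _ => increment i j k).Run st t (Function.update (Function.update st c []) i
        ((Computability.encodeNat (m + w.length)).map some)) := by
  intro w
  induction w with
  | nil =>
    intro m st hc hi hj hk
    refine (Run.loop_nil hc).exists_le ?_ (by simp)
    rw [List.length_nil, add_zero, ← hi, ← hc, Function.update_eq_self, Function.update_eq_self]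
  | cons s w ih =>
    intro m st hc hi hj hk
    obtain ⟨t, ht, r⟩ := run_increment hij hik hjk (Computability.encodeNat m)
      (Function.update st c w) (by simp [hci.symm, hi]) (by simp [hcj.symm, hj])
      (by simp [hck.symm, hk])
    obtain ⟨u, hu, r'⟩ := ih (m + 1)
      (Function.update (Function.update st c w) i
        ((binSucc (Computability.encodeNat m)).map some))
      (by rw [Function.update_of_ne hci, Function.update_self])
      (by rw [Function.update_self, encodeNat_succ])
      (by rw [Function.update_of_ne hij.symm, Function.update_of_ne hcj.symm, hj])
      (by rw [Function.update_of_ne hik.symm, Function.update_of_ne hck.symm, hk])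
    refine (Run.loop_cons hc r r').exists_le ?_ ?_
    · rw [show m + 1 + w.length = m + (s :: w).length by simp; omega]
      rw [Function.update_comm hci.symm, Function.update_idem, Function.update_idem]
    · have h1 := length_encodeNat_le m
      have h2 : m + 1 + w.length = m + (s :: w).length := by simp; omega
      rw [h2] at hu
      have h3 : m ≤ m + (s :: w).length := by omega
      generalize m + (s :: w).length = q at *
      rw [List.length_cons, Nat.succ_mul]
      omega

end Prog

namespace Comp

variable {Γ Γ' : Type} {V : Set (Γ → List (Option Bool))} {V' : Set (Γ' → List (Option Bool))}
  {F G : Γ → List (Option Bool)}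

/-- The traces of the comparison are removed before the chosen branch runs, so that it starts on the
original stacks. -/
theorem ifEq {A B : Γ → List (Option Bool)} (hF : Comp V F) (hG : Comp V G) (hA : Comp V A)
    (hB : Comp V B) : Comp V fun γ => if F γ = G γ then A γ else B γ := by
  obtain ⟨P, p, hp, hP⟩ := hF
  obtain ⟨Q, q, hq, hQ⟩ := hG
  obtain ⟨P₁, p₁, hp₁, hP₁⟩ := hA
  obtain ⟨P₂, p₂, hp₂, hP₂⟩ := hB
  refine ⟨fun loc o b => seq (P loc b (b + 3)) (seq (Q loc (b + 1) (b + 3))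
    (seq (compareLoop b (b + 1) (b + 2)) (seq (case (b + 1) skip fun _ => push (b + 2) none)
      (seq (loop (b + 1) fun _ => skip)
        (case (b + 2) (P₁ loc o b) fun _ => seq (loop (b + 2) fun _ => skip) (P₂ loc o b)))))),
    6 * p + 3 * q + 10 + p₁ + p₂, fun γ N h => ?_, fun loc o b γ st N h ho hb => ?_⟩
  · have h1 := hp₁ γ N h
    have h2 := hp₂ γ N h
    simp only [Polynomial.eval_add]
    split_ifs <;> omega
  · have hFl := hp γ N fun v hv => (h v hv).2.2.2
    have hGl := hq γ N fun v hv => (h v hv).2.2.2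
    obtain ⟨t₁, ht₁, r₁⟩ := hP loc b (b + 3) γ st N (fun v hv => by
      obtain ⟨h₁, h₂, h₃, h₄⟩ := h v hv
      exact ⟨by omega, by omega, h₃, h₄⟩) (by omega) (fun i hi => hb i (by omega))
    obtain ⟨t₂, ht₂, r₂⟩ := hQ loc (b + 1) (b + 3) γ
      (Function.update st b ((F γ).reverse ++ st b)) N (fun v hv => by
      obtain ⟨h₁, h₂, h₃, h₄⟩ := h v hv
      exact ⟨by omega, by omega, by rw [Function.update_of_ne (by omega), h₃], h₄⟩) (by omega)
      (fun i hi => by rw [Function.update_of_ne (by omega)]; exact hb i (by omega))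
    obtain ⟨t₃, ht₃, st₃, r₃, a1, a2, a3, a4, a5⟩ := run_compareLoop (i := b) (j := b + 1)
      (k := b + 2) (by omega) (by omega) (by omega) (F γ).reverse (G γ).reverse
      (Function.update (Function.update st b ((F γ).reverse ++ st b)) (b + 1)
        ((G γ).reverse ++ Function.update st b ((F γ).reverse ++ st b) (b + 1)))
      (by simp [hb b]) (by simp [hb (b + 1)])
    have hk : Function.update (Function.update st b ((F γ).reverse ++ st b)) (b + 1)
        ((G γ).reverse ++ Function.update st b ((F γ).reverse ++ st b) (b + 1)) (b + 2) = [] := by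
      rw [Function.update_of_ne (by omega), Function.update_of_ne (by omega), hb _ (by omega)]
    rw [hk] at a2 a4
    simp only [List.length_reverse, List.length_nil] at ht₃ a2 a3
    have a6 : st₃ (b + 2) = [] ∧ st₃ (b + 1) = [] ↔ F γ = G γ := by simp [a4]
    have a7 : ∀ x, x < b ∨ b + 2 < x → st₃ x = st x := by
      intro x hx
      rw [a5 x (by omega) (by omega) (by omega), Function.update_of_ne (by omega),
        Function.update_of_ne (by omega)]
    -- A remainder on `b + 1` is turned into a further mark, so that the stack of marks alone
    -- decides.
    have h5 : ∃ st₄, (case (b + 1) skip fun _ => push (b + 2) none).Run st₃ 2 st₄ ∧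
        (st₄ (b + 2)).length ≤ (F γ).length + 1 ∧ (st₄ (b + 1)).length ≤ (G γ).length ∧
        st₄ b = [] ∧ (st₄ (b + 2) = [] ↔ F γ = G γ) ∧ ∀ x, x < b ∨ b + 2 < x → st₄ x = st x := by
      rcases hm : st₃ (b + 1) with _ | ⟨s, l⟩
      · refine ⟨st₃, Run.case_nil hm (Run.skip _), by omega, by omega, a1, ?_, a7⟩
        rw [← a6, hm]
        simp
      · rw [hm] at a3
        refine ⟨_, Run.case_cons hm (Run.push (b + 2) none _), ?_, ?_, ?_, ?_, ?_⟩
        · simp; omega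
        · simp at a3 ⊢; omega
        · simp [a1]
        · rw [← a6, hm]
          simp
        · intro x hx
          rw [Function.update_of_ne (by omega), Function.update_of_ne (by omega), a7 x hx]
    obtain ⟨st₄, r₄, b1, b2, b3, b4, b5⟩ := h5
    have r₅ := run_clear (i := b + 1) _ st₄ rfl
    by_cases he : F γ = G γ
    · have hst : Function.update st₄ (b + 1) [] = st := by
        funext x
        by_cases x1 : x = b + 1
        · subst x1; rw [Function.update_self, hb _ (by omega)]
        rw [Function.update_of_ne x1]
        by_cases x2 : x = b
        · rw [x2, b3, hb _ le_rfl]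
        by_cases x3 : x = b + 2
        · rw [x3, b4.2 he, hb _ (by omega)]
        exact b5 x (by omega)
      rw [hst] at r₅
      obtain ⟨t₆, ht₆, r₆⟩ := hP₁ loc o b γ st N h ho hb
      refine (r₁.seq (r₂.seq (r₃.seq (r₄.seq (r₅.seq (Run.case_nil (hb _ (by omega)) r₆)))))).exists_le
        ?_ ?_
      · simp only [if_pos he]
      · simp
        omega
    · obtain ⟨s, l, hsl⟩ := List.exists_cons_of_ne_nil (mt b4.1 he)
      have r₆ := run_clear (i := b + 2) l (Function.update (Function.update st₄ (b + 1) []) (b + 2) l)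
        (by simp)
      have hst : Function.update (Function.update (Function.update st₄ (b + 1) []) (b + 2) l)
          (b + 2) [] = st := by
        funext x
        by_cases x3 : x = b + 2
        · subst x3; rw [Function.update_self, hb _ (by omega)]
        rw [Function.update_of_ne x3, Function.update_of_ne x3]
        by_cases x1 : x = b + 1
        · subst x1; rw [Function.update_self, hb _ (by omega)]
        rw [Function.update_of_ne x1]
        by_cases x2 : x = b
        · rw [x2, b3, hb _ le_rfl]
        exact b5 x (by omega)
      rw [hst] at r₆
      obtain ⟨t₇, ht₇, r₇⟩ := hP₂ loc o b γ st N h ho hb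
      have hc := Run.case_cons (i := b + 2) (Z := P₁ loc o b)
        (P := fun _ => seq (loop (b + 2) fun _ => skip) (P₂ loc o b))
        (a := Function.update st₄ (b + 1) []) (s := s) (l := l)
        (by rw [Function.update_of_ne (by omega), hsl]) (r₆.seq r₇)
      refine (r₁.seq (r₂.seq (r₃.seq (r₄.seq (r₅.seq hc))))).exists_le ?_ ?_
      · simp only [if_neg he]
      · rw [hsl, List.length_cons] at b1
        simp
        omega

theorem bin (hF : Comp V F) :
    Comp V fun γ => (Computability.encodeNat (F γ).length).map some := by
  obtain ⟨P, p, hp, hP⟩ := hF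
  refine ⟨fun loc o b => seq (P loc b (b + 1)) (seq (loop b fun _ => increment (b + 1) (b + 2) (b + 3))
    (loop (b + 1) fun s => push o s)), p + (p * (6 * p + 8) + 1) + (2 * p + 1), fun γ N h => ?_,
    fun loc o b γ st N h ho hb => ?_⟩
  · have h1 := hp γ N h
    have h2 := length_encodeNat_le (F γ).length
    simp only [Polynomial.eval_add, List.length_map]
    omega
  · have hFl := hp γ N fun v hv => (h v hv).2.2.2
    obtain ⟨t₁, ht₁, r₁⟩ := hP loc b (b + 1) γ st N (fun v hv => by
      obtain ⟨h₁, h₂, h₃, h₄⟩ := h v hv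
      exact ⟨by omega, by omega, h₃, h₄⟩) (by omega) (fun i hi => hb i (by omega))
    have h0 := hb b le_rfl
    have h1 := hb (b + 1) (by omega)
    have h2 := hb (b + 2) (by omega)
    have h3 := hb (b + 3) (by omega)
    obtain ⟨t₂, ht₂, r₂⟩ := run_count (c := b) (i := b + 1) (j := b + 2) (k := b + 3) (by omega)
      (by omega) (by omega) (by omega) (by omega) (by omega) (F γ).reverse 0
      (Function.update st b ((F γ).reverse ++ st b)) (by simp [h0])
      (by simp [h1, encodeNat_zero]) (by simp [h2]) (by simp [h3])
    have r₃ := run_move (i := b + 1) (j := o) (by omega) _ _ (Function.update_self (b + 1)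
      ((Computability.encodeNat (0 + (F γ).reverse.length)).map some)
      (Function.update (Function.update st b ((F γ).reverse ++ st b)) b []))
    refine (r₁.seq (r₂.seq r₃)).exists_le ?_ ?_
    · have h5 : o ≠ b := by omega
      have h6 : o ≠ b + 1 := by omega
      clear * - h0 h1 h5 h6
      funext x
      by_cases x1 : x = o
      · subst x1; simp [h5, h6]
      by_cases x2 : x = b + 1
      · subst x2; simp [x1, h1]
      by_cases x3 : x = b
      · subst x3; simp [x1, h0]
      simp [x1, x2, x3]
    · have h4 := length_encodeNat_le (F γ).length
      have h5 : (F γ).length * (6 * (F γ).length + 8) ≤ p.eval N * (6 * p.eval N + 8) :=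
        Nat.mul_le_mul hFl (by omega)
      simp at ht₂ ⊢
      omega

end Comp

/-! ### Arithmetic in unary, bits, and bounded loops -/

/-- A number in unary. -/
def unary (n : ℕ) : List (Option Bool) := List.replicate n (some true)

theorem unary_inj {m n : ℕ} : unary m = unary n ↔ m = n := by
  simp [unary, List.replicate_inj]

theorem bindPrefix_append (f : Option Bool → List (Option Bool) → List (Option Bool))
    (a b : List (Option Bool)) : ∀ pre, bindPrefix f pre (a ++ b) =
      bindPrefix f pre a ++ bindPrefix f (a.reverse ++ pre) b := by
  induction a with
  | nil => intro pre; simp [bindPrefix]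
  | cons s a ih => intro pre; simp [bindPrefix, ih]

theorem bindPrefix_const (g : Option Bool → List (Option Bool)) (l : List (Option Bool)) :
    ∀ pre, bindPrefix (fun s _ => g s) pre l = l.flatMap g := by
  induction l with
  | nil => intro pre; simp [bindPrefix]
  | cons s a ih => intro pre; simp [bindPrefix, ih]

theorem bindPrefix_unary (g : ℕ → List (Option Bool)) (n : ℕ) : ∀ pre,
    bindPrefix (fun _ pre => g pre.length) pre (unary n) =
      (List.range n).flatMap fun i => g (pre.length + i) := by
  induction n with
  | zero => intro pre; simp [bindPrefix, unary]
  | succ n ih =>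
    intro pre
    have := ih (some true :: pre)
    simp only [unary] at this
    simp only [unary, List.replicate_succ, bindPrefix, this, List.range_succ_eq_map,
      List.flatMap_cons, List.flatMap_map, List.length_cons, add_zero]
    congr 2
    funext i
    congr 1
    omega

/-- Random access by a loop: the symbol wanted is the one with exactly `m` symbols before it. -/
theorem bindPrefix_getElem? (m : ℕ) (l : List (Option Bool)) : ∀ pre : List (Option Bool),
    bindPrefix (fun s pre => if unary pre.length = unary m then [s] else []) pre l =
      if pre.length ≤ m then (l[m - pre.length]?).toList else [] := by
  induction l with
  | nil => intro pre; simp [bindPrefix]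
  | cons s l ih =>
    intro pre
    rw [bindPrefix, ih, List.length_cons]
    simp only [unary_inj]
    rcases lt_trichotomy pre.length m with h | h | h
    · rw [if_neg (by omega), if_pos (by omega), if_pos (by omega)]
      obtain ⟨d, hd⟩ : ∃ d, m - pre.length = d + 1 := ⟨m - pre.length - 1, by omega⟩
      rw [hd, show m - (pre.length + 1) = d by omega]
      simp
    · simp [h]
    · rw [if_neg (by omega), if_neg (by omega), if_neg (by omega)]
      rfl

/-- The variables in a context that has been extended by a number. -/
def extNat {Γ : Type} (V : Set (Γ → List (Option Bool))) : Set (Γ × ℕ → List (Option Bool)) :=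
  insert (fun p => unary p.2) ((fun v => v ∘ Prod.fst) '' V)

/-- The number `n γ` can be computed in unary in polynomial time. -/
def CompN {Γ : Type} (V : Set (Γ → List (Option Bool))) (n : Γ → ℕ) : Prop :=
  Comp V fun γ => unary (n γ)

/-- The bit `b γ` can be computed in polynomial time. -/
def CompB {Γ : Type} (V : Set (Γ → List (Option Bool))) (b : Γ → Bool) : Prop :=
  Comp V fun γ => [some (b γ)]

section

variable {Γ Γ' : Type} {V : Set (Γ → List (Option Bool))} {V' : Set (Γ' → List (Option Bool))}
  {F G : Γ → List (Option Bool)} {m n : Γ → ℕ} {b c : Γ → Bool}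

namespace Comp

theorem flatMap (hF : Comp V F) (g : Option Bool → List (Option Bool)) :
    Comp V fun γ => (F γ).flatMap g := by
  have := hF.forEach (f := fun s _ => g s) fun s => const _
  simpa only [bindPrefix_const] using this

theorem unary_length (hF : Comp V F) : CompN V fun γ => (F γ).length := by
  have := hF.flatMap fun _ => [some true]
  have e : (fun γ => (F γ).flatMap fun _ => [some true]) = fun γ => unary (F γ).length := by
    funext γ
    unfold unary
    induction F γ with
    | nil => rfl
    | cons s l ih => simp [List.replicate_succ, ih]
  rw [e] at this
  exact this

theorem unary_count_none (hF : Comp V F) : CompN V fun γ => (F γ).count none := by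
  have := hF.flatMap fun s => if s = none then [some true] else []
  have e : (fun γ => (F γ).flatMap fun s => if s = none then [some true] else []) =
      fun γ => unary ((F γ).count none) := by
    funext γ
    unfold unary
    induction F γ with
    | nil => rfl
    | cons s l ih =>
      rcases s with _ | s
      · simp only [List.flatMap_cons, ih, List.count_cons_self, List.replicate_succ]
        rfl
      · simp [ih]
  rw [e] at this
  exact this

theorem up (hF : Comp V F) : Comp (extNat V) fun p => F p.1 :=
  hF.comap Prod.fst fun _ hv => Set.mem_insert_of_mem _ (Set.mem_image_of_mem _ hv)

theorem upWord (hF : Comp V F) : Comp (extWord V) fun p => F p.1 :=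
  hF.comap Prod.fst fun _ hv => Set.mem_insert_of_mem _ (Set.mem_image_of_mem _ hv)

theorem word : Comp (extWord V) Prod.snd := var (Set.mem_insert _ _)

/-- The loop runs over a unary word, and the length of the processed prefix is the index. -/
theorem flatMapRange (hn : CompN V n) {f : Γ × ℕ → List (Option Bool)}
    (hf : Comp (extNat V) f) : Comp V fun γ => (List.range (n γ)).flatMap fun i => f (γ, i) := by
  have h1 : Comp (extWord V) fun p => f (p.1, p.2.length) := by
    refine (word.unary_length : Comp (extWord V) _).letVar ?_
    refine hf.comap (fun p : Γ × List (Option Bool) => (p.1, p.2.length)) ?_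
    rintro v (rfl | ⟨w, hw, rfl⟩)
    · exact Set.mem_insert _ _
    · exact Set.mem_insert_of_mem _ (Set.mem_insert_of_mem _ (Set.mem_image_of_mem _ hw))
  have := Comp.forEach hn (f := fun _ p => f (p.1, p.2.length)) fun s => h1
  have e : ∀ γ, bindPrefix (fun _ pre => f (γ, pre.length)) [] (unary (n γ)) =
      (List.range (n γ)).flatMap fun i => f (γ, i) := by
    intro γ
    simp [bindPrefix_unary (fun i => f (γ, i))]
  simpa only [e] using this

theorem getElem? (hF : Comp V F) (hn : CompN V n) : Comp V fun γ => ((F γ)[n γ]?).toList := by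
  have := hF.forEach (f := fun s p => if unary p.2.length = unary (n p.1) then [s] else [])
    fun s => ifEq word.unary_length hn.upWord (const _) (const _)
  simpa [bindPrefix_getElem?] using this

theorem congr (hF : Comp V F) (h : ∀ γ, F γ = G γ) : Comp V G := by
  rwa [← show F = G from funext h]

end Comp

namespace CompB

theorem ite (hb : CompB V b) (hF : Comp V F) (hG : Comp V G) :
    Comp V fun γ => if b γ = true then F γ else G γ :=
  (Comp.ifEq hb (Comp.const [some true]) hF hG).congr fun γ => by simp

theorem of_eq (hF : Comp V F) (hG : Comp V G) : CompB V fun γ => decide (F γ = G γ) :=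
  (hF.ifEq hG (Comp.const [some true]) (Comp.const [some false])).congr fun γ => by
    by_cases h : F γ = G γ <;> simp [h]

theorem congr (hb : CompB V b) (h : ∀ γ, b γ = c γ) : CompB V c := by
  rwa [← show b = c from funext h]

theorem const (b : Bool) : CompB V fun _ => b := Comp.const _

theorem not (hb : CompB V b) : CompB V fun γ => !b γ :=
  (hb.ite (const false) (const true)).congr fun γ => by
    dsimp only; cases b γ <;> simp

theorem and (hb : CompB V b) (hc : CompB V c) : CompB V fun γ => b γ && c γ :=
  (hb.ite hc (const false)).congr fun γ => by
    dsimp only; cases b γ <;> simp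

theorem or (hb : CompB V b) (hc : CompB V c) : CompB V fun γ => b γ || c γ :=
  (hb.ite (const true) hc).congr fun γ => by
    dsimp only; cases b γ <;> simp

theorem eqNat (hm : CompN V m) (hn : CompN V n) : CompB V fun γ => decide (m γ = n γ) :=
  (of_eq hm hn).congr fun γ => by simp [unary_inj]

theorem exists_lt (hn : CompN V n) {b : Γ × ℕ → Bool} (hb : CompB (extNat V) b) :
    CompB V fun γ => decide (∃ i < n γ, b (γ, i) = true) :=
  ((of_eq (Comp.flatMapRange hn (hb.ite (Comp.const [some true]) (Comp.const [])))
    (Comp.const [])).not).congr fun γ => by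
    simp only [List.flatMap_eq_nil_iff, List.mem_range]
    rw [← decide_not]
    congr 1
    simp

theorem getElem? (hF : Comp V F) (hn : CompN V n) :
    CompB V fun γ => decide ((F γ)[n γ]? = some (some true)) :=
  (of_eq (hF.getElem? hn) (Comp.const [some true])).congr fun γ => by
    rcases (F γ)[n γ]? with _ | s <;> simp

end CompB

namespace CompN

theorem congr (hm : CompN V m) (h : ∀ γ, m γ = n γ) : CompN V n := by
  rwa [← show m = n from funext h]

theorem const (n : ℕ) : CompN V fun _ => n := Comp.const _

theorem up (hn : CompN V n) : CompN (extNat V) fun p => n p.1 := Comp.up hn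

theorem index : CompN (extNat V) fun p => p.2 := Comp.var (Set.mem_insert _ _)

theorem add (hm : CompN V m) (hn : CompN V n) : CompN V fun γ => m γ + n γ :=
  (Comp.append hm hn).congr fun γ => by
    simp only [unary, List.replicate_add]

theorem sum_range (hn : CompN V n) {f : Γ × ℕ → ℕ} (hf : CompN (extNat V) f) :
    CompN V fun γ => ∑ i ∈ Finset.range (n γ), f (γ, i) :=
  (Comp.flatMapRange hn hf).congr fun γ => by
    dsimp only
    generalize n γ = k
    induction k with
    | zero => rfl
    | succ k ih =>
      rw [List.range_succ, List.flatMap_append, ih, Finset.sum_range_succ]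
      simp [unary]

theorem mul (hm : CompN V m) (hn : CompN V n) : CompN V fun γ => m γ * n γ :=
  (hm.sum_range hn.up).congr fun γ => by simp

theorem ite (hb : CompB V b) (hm : CompN V m) (hn : CompN V n) :
    CompN V fun γ => if b γ = true then m γ else n γ :=
  (CompB.ite hb hm hn).congr fun γ => by
    dsimp only; split_ifs <;> rfl

end CompN

theorem CompB.ltNat (hm : CompN V m) (hn : CompN V n) : CompB V fun γ => decide (m γ < n γ) :=
  (CompB.exists_lt hn (eqNat hm.up CompN.index)).congr fun γ => by simp

theorem CompB.leNat (hm : CompN V m) (hn : CompN V n) : CompB V fun γ => decide (m γ ≤ n γ) :=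
  (CompB.ltNat hn hm).not.congr fun γ => by rw [← decide_not]; simp

/-! ### Splitting a word at its separators -/

/-- The part of a word between its `j`-th and its next separator. -/
def wordSegment (j : ℕ) (w : List (Option Bool)) : List (Option Bool) :=
  bindPrefix (fun s pre => if s.isSome ∧ pre.count none = j then [s] else []) [] w

theorem Comp.segment (hF : Comp V F) (hn : CompN V n) :
    Comp V fun γ => wordSegment (n γ) (F γ) := by
  refine (hF.forEach (f := fun s p => if s.isSome ∧ p.2.count none = n p.1 then [s] else [])
    fun s => ?_)
  cases s with
  | none => exact (Comp.const []).congr fun γ => by simp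
  | some s =>
    exact (ifEq (unary_count_none word) hn.upWord (Comp.const [some s]) (Comp.const [])).congr
      fun γ => by simp [unary_inj]

end

theorem bindPrefix_segment_map_some (j : ℕ) (l : List Bool) : ∀ pre : List (Option Bool),
    bindPrefix (fun s pre => if s.isSome ∧ pre.count none = j then [s] else []) pre (l.map some) =
      if pre.count none = j then l.map some else [] := by
  induction l with
  | nil => intro pre; simp [bindPrefix]
  | cons b l ih =>
    intro pre
    simp only [List.map_cons, bindPrefix, ih]
    by_cases h : pre.count none = j <;> simp [h]

/-- The number of separators before a symbol is the index of its block. A block that does not exist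
reads as empty. -/
theorem bindPrefix_segment_flatMap (j : ℕ) (L : List (List Bool)) : ∀ pre : List (Option Bool),
    bindPrefix (fun s pre => if s.isSome ∧ pre.count none = j then [s] else []) pre
        (L.flatMap fun l => l.map some ++ [none]) =
      if pre.count none ≤ j then (L.getD (j - pre.count none) []).map some else [] := by
  induction L with
  | nil => intro pre; simp [bindPrefix]
  | cons l L ih =>
    intro pre
    have hc : ((l.map some).reverse ++ pre).count none = pre.count none := by
      rw [List.count_append, List.count_eq_zero.2 (by simp), zero_add]
    rw [List.flatMap_cons, bindPrefix_append, bindPrefix_append, bindPrefix_segment_map_some, ih]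
    have hc' : ([none].reverse ++ ((l.map some).reverse ++ pre)).count none =
        pre.count none + 1 := by
      simp only [List.reverse_singleton, List.singleton_append, List.count_cons_self, hc]
    have hc'' : (([none] : List (Option Bool)).reverse ++ (List.map some l).reverse ++ pre).count none =
        pre.count none + 1 := by
      rw [List.append_assoc, hc']
    simp only [List.reverse_append, hc'']
    rcases lt_trichotomy (pre.count none) j with h | h | h
    · obtain ⟨d, hd⟩ : ∃ d, j - pre.count none = d + 1 := ⟨j - pre.count none - 1, by omega⟩
      rw [if_neg (by omega), if_pos (by omega), if_pos (by omega), hd,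
        show j - (pre.count none + 1) = d by omega]
      simp [bindPrefix]
    · simp [bindPrefix, h]
    · rw [if_neg (by omega), if_neg (by omega), if_neg (by omega)]
      simp [bindPrefix]

theorem segment_flatMap (j : ℕ) (L : List (List Bool)) :
    wordSegment j (L.flatMap fun l => l.map some ++ [none]) = (L.getD j []).map some := by
  simp [wordSegment, bindPrefix_segment_flatMap]

/-! ### Counting edges of induced subgraphs -/

open Classical in
/-- The number of pairs of elements of `S` that are related. -/
def relCount {α : Type} (R : α → α → Prop) (S : Finset α) : ℕ :=
  ((S ×ˢ S).filter fun p => R p.1 p.2).card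

theorem relCount_mono {α : Type} {R : α → α → Prop} {S T : Finset α} (h : S ⊆ T) :
    relCount R S ≤ relCount R T := by
  classical
  exact Finset.card_le_card (Finset.filter_subset_filter _ (Finset.product_subset_product h h))

theorem relCount_map {α β : Type} (f : α ↪ β) (R : β → β → Prop) (S : Finset α) :
    relCount R (S.map f) = relCount (fun x y => R (f x) (f y)) S := by
  classical
  unfold relCount
  rw [← Finset.card_map (f.prodMap f)]
  congr 1
  ext ⟨x, y⟩
  simp only [Finset.mem_filter, Finset.mem_product, Finset.mem_map, Function.Embedding.coe_prodMap,
    Prod.exists, Prod.map_apply, Prod.mk.injEq]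
  constructor
  · rintro ⟨⟨⟨a, ha, rfl⟩, ⟨b, hb, rfl⟩⟩, h⟩
    exact ⟨a, b, ⟨⟨ha, hb⟩, h⟩, rfl, rfl⟩
  · rintro ⟨a, b, ⟨⟨ha, hb⟩, h⟩, rfl, rfl⟩
    exact ⟨⟨⟨a, ha, rfl⟩, ⟨b, hb, rfl⟩⟩, h⟩

/-- An asymmetric `R` orients every edge, which replaces unordered by ordered pairs in the counting.
-/
theorem numEdges_induce {V : Type} (G : SimpleGraph V) (R : V → V → Prop)
    (hR : ∀ x y, G.Adj x y ↔ R x y ∨ R y x) (hR' : ∀ x y, R x y → ¬ R y x) (S : Finset V) :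
    numEdges (G.induce (S : Set V)) = relCount R S := by
  classical
  unfold numEdges relCount
  rw [← Set.ncard_coe_finset]
  symm
  refine Set.ncard_congr (fun p hp => s(⟨p.1, ?_⟩, ⟨p.2, ?_⟩)) ?_ ?_ ?_
  · exact (Finset.mem_product.1 (Finset.mem_filter.1 hp).1).1
  · exact (Finset.mem_product.1 (Finset.mem_filter.1 hp).1).2
  · intro p hp
    rw [SimpleGraph.mem_edgeSet]
    exact (hR _ _).2 (Or.inl (Finset.mem_filter.1 hp).2)
  · rintro ⟨a, b⟩ ⟨c, d⟩ hp hq h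
    have h1 := (Finset.mem_filter.1 hp).2
    have h2 := (Finset.mem_filter.1 hq).2
    simp only [Sym2.eq_iff, Subtype.mk.injEq] at h
    rcases h with ⟨rfl, rfl⟩ | ⟨rfl, rfl⟩
    · rfl
    · exact absurd h2 (hR' _ _ h1)
  · intro e
    induction e using Sym2.inductionOn with
    | hf x y =>
      intro he
      rw [SimpleGraph.mem_edgeSet] at he
      rcases (hR _ _).1 he with h | h
      · exact ⟨(x, y), by have h : R x y := h; simp [h], rfl⟩
      · exact ⟨(y, x), by have h : R y x := h; simp [h], Sym2.eq_swap⟩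

theorem relCount_adj {V : Type} [LinearOrder V] (G : SimpleGraph V) (S : Finset V) :
    relCount G.Adj S = 2 * numEdges (G.induce (S : Set V)) := by
  classical
  rw [numEdges_induce G (fun x y => G.Adj x y ∧ x < y)
    (fun x y => ⟨fun h => (lt_or_gt_of_ne h.ne).imp (fun h' => ⟨h, h'⟩) fun h' => ⟨h.symm, h'⟩,
      fun h => h.elim (fun h => h.1) fun h => h.1.symm⟩)
    (fun x y h h' => lt_asymm h.2 h'.2) S]
  unfold relCount
  have h1 : ((S ×ˢ S).filter fun p => G.Adj p.1 p.2) =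
      ((S ×ˢ S).filter fun p => G.Adj p.1 p.2 ∧ p.1 < p.2) ∪
        ((S ×ˢ S).filter fun p => G.Adj p.1 p.2 ∧ p.1 < p.2).map
          (Equiv.prodComm V V).toEmbedding := by
    ext ⟨x, y⟩
    simp only [Finset.mem_filter, Finset.mem_product, Finset.mem_union, Finset.mem_map,
      Equiv.coe_toEmbedding, Equiv.prodComm_apply, Prod.exists, Prod.swap_prod_mk, Prod.mk.injEq]
    constructor
    · rintro ⟨⟨hx, hy⟩, h⟩
      rcases lt_or_gt_of_ne h.ne with h' | h'
      · exact Or.inl ⟨⟨hx, hy⟩, h, h'⟩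
      · exact Or.inr ⟨y, x, ⟨⟨hy, hx⟩, h.symm, h'⟩, rfl, rfl⟩
    · rintro (⟨⟨hx, hy⟩, h, -⟩ | ⟨a, b, ⟨⟨ha, hb⟩, h, -⟩, rfl, rfl⟩)
      · exact ⟨⟨hx, hy⟩, h⟩
      · exact ⟨⟨hb, ha⟩, h.symm⟩
  have hd : Disjoint ((S ×ˢ S).filter fun p => G.Adj p.1 p.2 ∧ p.1 < p.2)
      (((S ×ˢ S).filter fun p => G.Adj p.1 p.2 ∧ p.1 < p.2).map
        (Equiv.prodComm V V).toEmbedding) := by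
    rw [Finset.disjoint_left]
    rintro ⟨x, y⟩ h h'
    simp only [Finset.mem_filter, Finset.mem_product, Finset.mem_map,
        Equiv.coe_toEmbedding, Equiv.prodComm_apply, Prod.exists, Prod.swap_prod_mk,
        Prod.mk.injEq] at h h'
    obtain ⟨a, b, ⟨-, -, h2⟩, rfl, rfl⟩ := h'
    exact lt_asymm h.2.2 h2
  rw [h1, Finset.card_union_of_disjoint hd, Finset.card_map, ← two_mul]
  congr!

theorem relCount_adj_le_maxEdgesEq {n : ℕ} (G : SimpleGraph (Fin n)) {k : ℕ} (hk : k ≤ n)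
    {S : Finset (Fin n)} (hS : S.card ≤ k) : relCount G.Adj S ≤ 2 * maxEdgesEq G k := by
  obtain ⟨T, hST, hT⟩ := Finset.exists_superset_card_eq hS (by simpa using hk)
  refine (relCount_mono hST).trans ?_
  rw [relCount_adj]
  refine Nat.mul_le_mul_left _ ?_
  exact Finset.le_sup (f := fun S : Finset (Fin n) => numEdges (G.induce (S : Set (Fin n))))
    (Finset.mem_powersetCard.2 ⟨Finset.subset_univ _, hT⟩)

/-- A graph without dense subgraphs on `k` vertices has no dense subgraphs that are larger by a
constant factor. -/
theorem relCount_adj_le_mul_maxEdgesEq {n : ℕ} (G : SimpleGraph (Fin n)) {k h B : ℕ} (hk : k ≤ n)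
    (hh : 2 * h ≤ k) (hh' : 0 < h) {S : Finset (Fin n)} (hS : S.card ≤ B * h) :
    relCount G.Adj S ≤ B * B * (2 * maxEdgesEq G k) := by
  classical
  -- An enumeration of `S` is cut into `B` blocks of at most `h` vertices. Every adjacent pair lies
  -- in the union of two blocks, which has at most `2 * h ≤ k` vertices; there are `B * B` choices
  -- of the blocks.
  let idx : Fin n → ℕ := fun x => if hx : x ∈ S then (S.equivFin ⟨x, hx⟩ : ℕ) / h else 0
  have hidx : ∀ x ∈ S, idx x < B := by
    intro x hx
    simp only [idx, dif_pos hx]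
    exact Nat.div_lt_of_lt_mul (by
      have := (S.equivFin ⟨x, hx⟩).2
      rw [mul_comm]; omega)
  have hfib : ∀ c, (S.filter fun x => idx x = c).card ≤ h := by
    intro c
    have : (S.filter fun x => idx x = c).card ≤ (Finset.Ico (c * h) (c * h + h)).card := by
      refine Finset.card_le_card_of_injOn
        (fun x => if hx : x ∈ S then (S.equivFin ⟨x, hx⟩ : ℕ) else 0) ?_ ?_
      · intro x hx
        obtain ⟨hx, hc⟩ := Finset.mem_filter.1 hx
        simp only [idx, dif_pos hx] at hc
        simp only [dif_pos hx, Finset.coe_Ico, Set.mem_Ico]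
        subst hc
        exact ⟨Nat.div_mul_le_self _ _, Nat.lt_div_mul_add hh'⟩
      · intro x hx y hy hxy
        have hx := (Finset.mem_filter.1 hx).1
        have hy := (Finset.mem_filter.1 hy).1
        simp only [dif_pos hx, dif_pos hy] at hxy
        simpa using S.equivFin.injective (Fin.ext hxy)
    simpa using this
  have hsub : ((S ×ˢ S).filter fun p => G.Adj p.1 p.2) ⊆
      (Finset.range B ×ˢ Finset.range B).biUnion fun c =>
        let U := (S.filter fun x => idx x = c.1) ∪ S.filter fun x => idx x = c.2
        (U ×ˢ U).filter fun p => G.Adj p.1 p.2 := by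
    rintro ⟨x, y⟩ hxy
    obtain ⟨h1, h2⟩ := Finset.mem_filter.1 hxy
    obtain ⟨hx, hy⟩ := Finset.mem_product.1 h1
    simp only [Finset.mem_biUnion, Finset.mem_product, Finset.mem_range, Finset.mem_filter,
      Finset.mem_union]
    exact ⟨(idx x, idx y), ⟨hidx x hx, hidx y hy⟩, ⟨Or.inl ⟨hx, rfl⟩, Or.inr ⟨hy, rfl⟩⟩, h2⟩
  refine (Finset.card_le_card hsub).trans ?_
  refine (Finset.card_biUnion_le_card_mul _ _ (2 * maxEdgesEq G k) ?_).trans (by simp)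
  intro c _
  refine relCount_adj_le_maxEdgesEq G hk ((Finset.card_union_le _ _).trans ?_)
  have h1 := hfib c.1
  have h2 := hfib c.2
  omega

/-! ### The graph of the reduction -/

/-- The vertices of the graph of the reduction: copies of the vertices `u` of the given graph in
layers `i`, copies of the pairs of vertices, and the two sides of a complete bipartite graph. -/
inductive RVertex
  | layer (i u : ℕ)
  | pair (a b j : ℕ)
  | left (c : ℕ)
  | right (c : ℕ)
  deriving DecidableEq

/-- The edges of the graph of the reduction, with a direction. -/
def RVertex.Rel (A : ℕ → ℕ → Prop) : RVertex → RVertex → Prop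
  | pair a b _, layer _ u => A a b ∧ (u = a ∨ u = b)
  | left _, right _ => True
  | _, _ => False

theorem RVertex.Rel.asymm {A : ℕ → ℕ → Prop} {x y : RVertex} (h : x.Rel A y) : ¬ y.Rel A x := by
  cases x <;> cases y <;> simp_all [RVertex.Rel]

/-- The list of the vertices of the graph of the reduction. -/
def rVertices (n w M q₁ q₂ : ℕ) : List RVertex :=
  ((List.range w).flatMap fun i => (List.range n).map fun u => RVertex.layer i u) ++
  (((List.range n).flatMap fun a => (List.range n).flatMap fun b =>
      (List.range M).map fun j => RVertex.pair a b j) ++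
  ((List.range q₁).map RVertex.left ++ (List.range q₂).map RVertex.right))

section

variable {n w M q₁ q₂ : ℕ}

theorem layer_mem_rVertices {i u : ℕ} :
    RVertex.layer i u ∈ rVertices n w M q₁ q₂ ↔ i < w ∧ u < n := by
  simp [rVertices]

theorem pair_mem_rVertices {a b j : ℕ} :
    RVertex.pair a b j ∈ rVertices n w M q₁ q₂ ↔ a < n ∧ b < n ∧ j < M := by
  simp [rVertices]

theorem left_mem_rVertices {c : ℕ} : RVertex.left c ∈ rVertices n w M q₁ q₂ ↔ c < q₁ := by
  simp [rVertices]

theorem right_mem_rVertices {c : ℕ} : RVertex.right c ∈ rVertices n w M q₁ q₂ ↔ c < q₂ := by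
  simp [rVertices]

theorem nodup_rVertices (n w M q₁ q₂ : ℕ) : (rVertices n w M q₁ q₂).Nodup := by
  have h : ∀ {α : Type} (m : ℕ) (f : ℕ → List α), (∀ i, (f i).Nodup) →
      (∀ i j x, x ∈ f i → x ∈ f j → i = j) → ((List.range m).flatMap f).Nodup := by
    intro α m f h1 h2
    refine List.nodup_flatMap.2 ⟨fun i _ => h1 i, List.nodup_range.imp ?_⟩
    intro i j hij x hx hx'
    exact hij (h2 i j x hx hx')
  unfold rVertices
  refine List.Nodup.append (h _ _ (fun i => ?_) (by simp; grind)) (List.Nodup.append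
    (h _ _ (fun a => h _ _ (fun b => ?_) (by simp; grind)) (by simp; grind))
    (List.Nodup.append ?_ ?_ ?_) ?_) ?_
  · exact List.nodup_range.map fun _ _ h => by simpa using h
  · exact List.nodup_range.map fun _ _ h => by simpa using h
  · exact List.nodup_range.map fun _ _ h => by simpa using h
  · exact List.nodup_range.map fun _ _ h => by simpa using h
  · intro x; simp; grind
  · intro x; simp; grind
  · intro x; simp; grind

theorem length_rVertices (n w M q₁ q₂ : ℕ) :
    (rVertices n w M q₁ q₂).length = w * n + (n * (n * M) + (q₁ + q₂)) := by
  simp [rVertices]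

/-- The graph of the reduction. -/
def rGraph (A : ℕ → ℕ → Prop) (n w M q₁ q₂ : ℕ) :
    SimpleGraph (Fin (rVertices n w M q₁ q₂).length) where
  Adj x y := ((rVertices n w M q₁ q₂).get x).Rel A ((rVertices n w M q₁ q₂).get y) ∨
    ((rVertices n w M q₁ q₂).get y).Rel A ((rVertices n w M q₁ q₂).get x)
  symm := ⟨fun _ _ h => h.symm⟩
  loopless := ⟨fun _ h => h.elim (fun h => h.asymm h) fun h => h.asymm h⟩

/-- The vertices of the graph of the reduction, as an embedding of its numbered vertices. -/
def rEmb (n w M q₁ q₂ : ℕ) : Fin (rVertices n w M q₁ q₂).length ↪ RVertex :=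
  ⟨(rVertices n w M q₁ q₂).get, List.nodup_iff_injective_get.1 (nodup_rVertices n w M q₁ q₂)⟩

/-- This moves the counting from positions in a list to sets of `RVertex`. -/
theorem graphDensity_rGraph (A : ℕ → ℕ → Prop) (S : Finset (Fin (rVertices n w M q₁ q₂).length)) :
    graphDensity ((rGraph A n w M q₁ q₂).induce (S : Set _)) =
      (relCount (RVertex.Rel A) (S.map (rEmb n w M q₁ q₂)) : ℝ) /
        ((S.map (rEmb n w M q₁ q₂)).card : ℝ) := by
  unfold graphDensity
  rw [numEdges_induce _ (fun x y => ((rVertices n w M q₁ q₂).get x).Rel A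
    ((rVertices n w M q₁ q₂).get y)) (fun x y => Iff.rfl) (fun x y h => h.asymm), relCount_map,
    Finset.card_map]
  congr 2
  simp

theorem exists_map_rEmb {S : Finset RVertex} (hS : ∀ x ∈ S, x ∈ rVertices n w M q₁ q₂) :
    ∃ S' : Finset (Fin (rVertices n w M q₁ q₂).length), S'.map (rEmb n w M q₁ q₂) = S := by
  classical
  refine ⟨Finset.univ.filter fun x => rEmb n w M q₁ q₂ x ∈ S, ?_⟩
  ext x
  simp only [Finset.mem_map, Finset.mem_filter, Finset.mem_univ, true_and]
  constructor
  · rintro ⟨y, hy, rfl⟩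
    exact hy
  · intro hx
    obtain ⟨y, hy⟩ := List.get_of_mem (hS x hx)
    exact ⟨y, by rw [← hy] at hx; exact hx, hy⟩

end

/-! ### Dense subgraphs of the graph of the reduction. -/

section
variable {n w M q₁ q₂ : ℕ}

open Classical in
/-- The vertices of a layer that belong to a set of vertices. -/
def layerSet (n : ℕ) (S : Finset RVertex) (i : ℕ) : Finset ℕ :=
  (Finset.range n).filter fun u => RVertex.layer i u ∈ S

open Classical in
/-- The copies of pairs in a set of vertices. -/
def pairSet (S : Finset RVertex) : Finset RVertex :=
  S.filter fun x => ∃ a b j, x = RVertex.pair a b j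

/-- This is the price of large layers: their vertices are disjoint from the pairs and from each
other. -/
theorem card_pairSet_add_le (S : Finset RVertex) :
    (pairSet S).card + ∑ i ∈ Finset.range w, (layerSet n S i).card ≤ S.card := by
  classical
  have h1 : ∑ i ∈ Finset.range w, (layerSet n S i).card =
      ((Finset.range w).biUnion fun i => (layerSet n S i).image (RVertex.layer i)).card := by
    rw [Finset.card_biUnion]
    · refine Finset.sum_congr rfl fun i _ => ?_
      rw [Finset.card_image_of_injective _ fun _ _ h => by simpa using h]
    · intro i _ j _ hij
      simp only [Function.onFun, Finset.disjoint_left, Finset.mem_image]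
      rintro _ ⟨u, -, rfl⟩ ⟨v, -, h⟩
      simp at h
      exact hij h.1.symm
  rw [h1, ← Finset.card_union_of_disjoint]
  · refine Finset.card_le_card (Finset.union_subset (Finset.filter_subset _ _) ?_)
    intro x hx
    simp only [Finset.mem_biUnion, Finset.mem_image, layerSet, Finset.mem_filter] at hx
    obtain ⟨i, -, u, ⟨-, hu⟩, rfl⟩ := hx
    exact hu
  · rw [Finset.disjoint_left]
    intro x hx hx'
    simp only [pairSet, Finset.mem_filter] at hx
    obtain ⟨-, a, b, j, rfl⟩ := hx
    simp at hx'

open Classical in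
/-- The number of edges between copies of pairs and vertices of a layer in a set of vertices. -/
def layerEdges (A : ℕ → ℕ → Prop) (n : ℕ) (S : Finset RVertex) (i : ℕ) : ℕ :=
  ∑ x ∈ pairSet S, ((layerSet n S i).filter fun u => x.Rel A (RVertex.layer i u)).card

/-- The bipartite graph is charged in full, whatever part of it lies in `S`; all other edges join a
pair to a layer. -/
theorem relCount_le (A : ℕ → ℕ → Prop) {S : Finset RVertex}
    (hS : ∀ x ∈ S, x ∈ rVertices n w M q₁ q₂) :
    relCount (RVertex.Rel A) S ≤ q₁ * q₂ + ∑ i ∈ Finset.range w, layerEdges A n S i := by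
  classical
  have h1 : ((S ×ˢ S).filter fun p => p.1.Rel A p.2) ⊆
      ((Finset.range q₁ ×ˢ Finset.range q₂).image fun p => (RVertex.left p.1, RVertex.right p.2)) ∪
      (Finset.range w).biUnion fun i => (pairSet S).biUnion fun x =>
        ((layerSet n S i).filter fun u => x.Rel A (RVertex.layer i u)).image fun u =>
          (x, RVertex.layer i u) := by
    rintro ⟨x, y⟩ hp
    obtain ⟨hp, h⟩ := Finset.mem_filter.1 hp
    obtain ⟨hx, hy⟩ := Finset.mem_product.1 hp
    have hx' := hS x hx
    have hy' := hS y hy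
    rw [Finset.mem_union]
    cases x with
    | layer i u => cases y <;> exact absurd h (by simp [RVertex.Rel])
    | right c => cases y <;> exact absurd h (by simp [RVertex.Rel])
    | left c =>
      cases y with
      | right d =>
        left
        rw [left_mem_rVertices] at hx'
        rw [right_mem_rVertices] at hy'
        simp [hx', hy']
      | _ => exact absurd h (by simp [RVertex.Rel])
    | pair a b j =>
      cases y with
      | layer i u =>
        right
        rw [layer_mem_rVertices] at hy'
        simp only [Finset.mem_biUnion, Finset.mem_range, Finset.mem_image, Finset.mem_filter,
          pairSet, layerSet]
        exact ⟨i, hy'.1, RVertex.pair a b j, ⟨hx, a, b, j, rfl⟩, u, ⟨⟨hy'.2, hy⟩, h⟩, rfl⟩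
      | _ => exact absurd h (by simp [RVertex.Rel])
  refine (Finset.card_le_card h1).trans ((Finset.card_union_le _ _).trans (Nat.add_le_add ?_ ?_))
  · exact Finset.card_image_le.trans (by simp)
  · refine Finset.card_biUnion_le.trans (Finset.sum_le_sum fun i _ => ?_)
    refine Finset.card_biUnion_le.trans (Finset.sum_le_sum fun x _ => ?_)
    exact Finset.card_image_le

theorem layerEdges_le_two_mul (A : ℕ → ℕ → Prop) (S : Finset RVertex) (i : ℕ) :
    layerEdges A n S i ≤ 2 * (pairSet S).card := by
  classical
  unfold layerEdges
  rw [mul_comm, ← smul_eq_mul]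
  refine Finset.sum_le_card_nsmul _ _ _ fun x hx => ?_
  simp only [pairSet, Finset.mem_filter] at hx
  obtain ⟨-, a, b, j, rfl⟩ := hx
  refine (Finset.card_le_card (t := {a, b}) ?_).trans Finset.card_le_two
  intro u hu
  obtain ⟨-, -, hu⟩ := Finset.mem_filter.1 hu
  simpa using hu

/-- Beyond one edge per pair, a second edge requires both endpoints in the layer, so the pair is one
of the at most `M` copies of an adjacent ordered pair inside the layer. -/
theorem layerEdges_le (A : ℕ → ℕ → Prop) {S : Finset RVertex}
    (hS : ∀ x ∈ S, x ∈ rVertices n w M q₁ q₂) (i : ℕ) :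
    layerEdges A n S i ≤ (pairSet S).card + M * relCount A (layerSet n S i) := by
  classical
  obtain ⟨inner, hinner⟩ : ∃ inner : RVertex → Prop, ∀ x, inner x ↔
      ∃ a b j, x = RVertex.pair a b j ∧ a ∈ layerSet n S i ∧ b ∈ layerSet n S i ∧ A a b :=
    ⟨_, fun _ => Iff.rfl⟩
  have h1 : layerEdges A n S i ≤ ∑ x ∈ pairSet S, (1 + if inner x then 1 else 0) := by
    refine Finset.sum_le_sum fun x hx => ?_
    simp only [pairSet, Finset.mem_filter] at hx
    obtain ⟨-, a, b, j, rfl⟩ := hx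
    by_cases hin : inner (RVertex.pair a b j)
    · rw [if_pos hin]
      refine (Finset.card_le_card (t := {a, b}) ?_).trans Finset.card_le_two
      intro u hu
      obtain ⟨-, -, hu⟩ := Finset.mem_filter.1 hu
      simpa using hu
    · rw [if_neg hin, add_zero, Finset.card_le_one]
      intro u hu v hv
      obtain ⟨hu₁, hA, hu'⟩ := Finset.mem_filter.1 hu
      obtain ⟨hv₁, -, hv'⟩ := Finset.mem_filter.1 hv
      by_contra hne
      apply hin
      rw [hinner]
      rcases hu' with rfl | rfl <;> rcases hv' with rfl | rfl
      · exact absurd rfl hne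
      · exact ⟨_, _, j, rfl, hu₁, hv₁, hA⟩
      · exact ⟨_, _, j, rfl, hv₁, hu₁, hA⟩
      · exact absurd rfl hne
  have h2 : ((pairSet S).filter inner).card ≤ M * relCount A (layerSet n S i) := by
    have : (pairSet S).filter inner ⊆
        (((layerSet n S i ×ˢ layerSet n S i).filter fun p => A p.1 p.2) ×ˢ Finset.range M).image
          fun p => RVertex.pair p.1.1 p.1.2 p.2 := by
      intro x hx
      obtain ⟨hx, hi⟩ := Finset.mem_filter.1 hx
      obtain ⟨a, b, j, rfl, ha, hb, hA⟩ := (hinner x).1 hi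
      have hx' := pair_mem_rVertices.1 (hS _ (Finset.mem_filter.1 hx).1)
      rw [Finset.mem_image]
      exact ⟨((a, b), j), by simp [ha, hb, hA, hx'.2.2], rfl⟩
    refine (Finset.card_le_card this).trans (Finset.card_image_le.trans ?_)
    rw [Finset.card_product, Finset.card_range, mul_comm]
    rfl
  rw [Finset.sum_add_distrib, Finset.sum_const, smul_eq_mul, mul_one, ← Finset.card_filter] at h1
  refine h1.trans (Nat.add_le_add_left (le_trans (le_of_eq ?_) h2) _)
  congr!

/-- In a dense set of vertices, some small layer contains many edges of the given graph. -/
theorem exists_dense_layer (A : ℕ → ℕ → Prop) {k l r : ℕ} (hr : 0 < r)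
    {S : Finset RVertex}
    (hS : ∀ x ∈ S, x ∈ rVertices n l (r ^ 2 * k) (2 * l * r) (l * r * k))
    (hcard : 2 * r ^ 2 * k * l ≤ S.card)
    (hdense : (2 * r + 2) * l * S.card < r * relCount (RVertex.Rel A) S) :
    ∃ i < l, (layerSet n S i).card ≤ 2 * r ^ 4 * k ∧ l ≤ r * relCount A (layerSet n S i) := by
  classical
  by_contra! hcon
  refine absurd hdense (not_lt.2 ?_)
  have h1 := relCount_le A hS
  have h2 := card_pairSet_add_le (n := n) (w := l) S
  -- The layers that are too large to serve as certificates; the others contain few edges by `hcon`.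
  let bad := (Finset.range l).filter fun i => 2 * r ^ 4 * k < (layerSet n S i).card
  have hbad : bad.card ≤ l := (Finset.card_filter_le _ _).trans (by simp)
  set f := (pairSet S).card
  set s := S.card
  set m := 2 * r ^ 2 * k * l with hm
  -- The factor `2 * r` clears denominators: since `r * relCount < l` in a layer that is not bad,
  -- the second edges there number at most `m / (2 * r)`.
  have h3 : ∀ i ∈ Finset.range l, 2 * r * layerEdges A n S i ≤
      (2 * r * f + m) + if i ∈ bad then 2 * r * f else 0 := by
    intro i hi
    by_cases hb : i ∈ bad
    · rw [if_pos hb]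
      have := Nat.mul_le_mul_left (2 * r) (layerEdges_le_two_mul (n := n) A S i)
      have e : 2 * r * (2 * (pairSet S).card) = 2 * r * f + 2 * r * f := by ring
      omega
    · rw [if_neg hb]
      have hs : (layerSet n S i).card ≤ 2 * r ^ 4 * k := by
        by_contra h
        exact hb (Finset.mem_filter.2 ⟨hi, not_le.1 h⟩)
      have h4 := hcon i (Finset.mem_range.1 hi) hs
      have h5 := Nat.mul_le_mul_left (2 * r) (layerEdges_le A hS i)
      have h6 : 2 * (r ^ 2 * k) * (r * relCount A (layerSet n S i)) ≤ 2 * (r ^ 2 * k) * l :=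
        Nat.mul_le_mul_left _ h4.le
      have e1 : 2 * r * ((pairSet S).card + r ^ 2 * k * relCount A (layerSet n S i)) =
        2 * r * f + 2 * (r ^ 2 * k) * (r * relCount A (layerSet n S i)) := by ring
      have e2 : 2 * (r ^ 2 * k) * l = m := by rw [hm]; ring
      omega
  have h4 : 2 * r * ∑ i ∈ Finset.range l, layerEdges A n S i ≤
      l * (2 * r * f + m) + bad.card * (2 * r * f) := by
    rw [Finset.mul_sum]
    refine (Finset.sum_le_sum h3).trans ?_
    rw [Finset.sum_add_distrib, Finset.sum_const, Finset.card_range, smul_eq_mul,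
      ← Finset.sum_filter, Finset.sum_const, smul_eq_mul]
    refine Nat.add_le_add_left (Nat.mul_le_mul_right _ (Finset.card_le_card ?_)) _
    intro i hi
    exact (Finset.mem_filter.1 hi).2
  have h5 : bad.card * (2 * r ^ 4 * k) ≤ ∑ i ∈ Finset.range l, (layerSet n S i).card := by
    rw [← smul_eq_mul]
    refine (Finset.card_nsmul_le_sum bad _ _ fun i hi => (Finset.mem_filter.1 hi).2.le).trans ?_
    exact Finset.sum_le_sum_of_subset (Finset.filter_subset _ _)
  set E := relCount (RVertex.Rel A) S
  set β := bad.card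
  have e3 : 2 * l * r * (l * r * k) = l * m := by rw [hm]; ring
  have hfs : f ≤ s := by omega
  have h6 : 2 * (r * E) ≤ 2 * r * (l * m) + l * (2 * r * f + m) + β * (2 * r * f) := by
    have := Nat.mul_le_mul_left (2 * r) h1
    rw [e3, Nat.mul_add] at this
    nlinarith
  have hlm : l * m ≤ l * s := Nat.mul_le_mul_left _ hcard
  have hlf : l * f ≤ l * s := Nat.mul_le_mul_left _ hfs
  have hrlm : r * (l * m) ≤ r * (l * s) := Nat.mul_le_mul_left _ hlm
  have hrlf : r * (l * f) ≤ r * (l * s) := Nat.mul_le_mul_left _ hlf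
  -- If there are at most `l / r` bad layers, their second edges number at most `l * s / r`, which
  -- the claim allows.
  by_cases hβ : β * r ≤ l
  · have h7 : β * r * f ≤ l * s := Nat.mul_le_mul hβ hfs
    nlinarith
  -- Otherwise the bad layers alone have at least `r * m` vertices. Then the `l * m` edges of the
  -- bipartite graph are at most `l * s / r`, and two edges per pair and layer are affordable.
  · have h8 : l * (2 * r ^ 4 * k) ≤ β * r * (2 * r ^ 4 * k) := Nat.mul_le_mul_right _ (by omega)
    have h9 : r * m ≤ s := by
      have e4 : l * (2 * r ^ 4 * k) = r * (r * m) := by rw [hm]; ring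
      have e5 : β * r * (2 * r ^ 4 * k) = r * (β * (2 * r ^ 4 * k)) := by ring
      rw [e4, e5] at h8
      have := Nat.le_of_mul_le_mul_left h8 hr
      omega
    have h10 : l * (r * m) ≤ l * s := Nat.mul_le_mul_left _ h9
    have h11 : β * (r * f) ≤ l * (r * s) :=
      Nat.mul_le_mul hbad (Nat.mul_le_mul_left _ hfs)
    nlinarith

/-- A set of vertices with many edges in the given graph yields a dense set of vertices. -/
theorem exists_dense_set {A : ℕ → ℕ → Prop} (hA : ∀ a, ¬ A a a) {k l r : ℕ} (hk : 2 ≤ k)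
    (hr : 0 < r) {K : Finset ℕ} (hK : ∀ u ∈ K, u < n) (hKk : K.card = k)
    (hKl : 2 * l ≤ relCount A K) :
    ∃ S : Finset RVertex, (∀ x ∈ S, x ∈ rVertices n l (r ^ 2 * k) (2 * l * r) (l * r * k)) ∧
      2 * r ^ 2 * k * l ≤ S.card ∧ r * S.card ≤ (r + 2) * (2 * r ^ 2 * k * l) ∧
      3 * l * (2 * r ^ 2 * k * l) ≤ relCount (RVertex.Rel A) S := by
  classical
  -- Keeping exactly `2 * l` ordered pairs makes the number of their copies exactly `2 * r ^ 2 * k *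
  -- l`, the size required.
  obtain ⟨P, hP, hPl⟩ := Finset.exists_subset_card_eq hKl
  have hP' : ∀ a b, (a, b) ∈ P → a ∈ K ∧ b ∈ K ∧ A a b := by
    intro a b hab
    have := hP hab
    simp only [Finset.mem_filter, Finset.mem_product] at this
    exact ⟨this.1.1, this.1.2, this.2⟩
  let S₁ : Finset RVertex := (Finset.range l ×ˢ K).image fun p => RVertex.layer p.1 p.2
  let S₂ : Finset RVertex :=
    (P ×ˢ Finset.range (r ^ 2 * k)).image fun p => RVertex.pair p.1.1 p.1.2 p.2
  let S₃ : Finset RVertex := (Finset.range (2 * l * r)).image RVertex.left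
  let S₄ : Finset RVertex := (Finset.range (l * r * k)).image RVertex.right
  have c₂ : S₂.card = 2 * r ^ 2 * k * l := by
    rw [Finset.card_image_of_injective _ (by rintro ⟨⟨a, b⟩, j⟩ ⟨⟨a', b'⟩, j'⟩ h; simpa [and_assoc] using h)]
    simp [hPl]
    ring
  have c₁ : S₁.card ≤ l * k := Finset.card_image_le.trans (by simp [hKk])
  have c₃ : S₃.card ≤ 2 * l * r := Finset.card_image_le.trans (by simp)
  have c₄ : S₄.card ≤ l * r * k := Finset.card_image_le.trans (by simp)
  refine ⟨S₁ ∪ S₂ ∪ S₃ ∪ S₄, ?_, ?_, ?_, ?_⟩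
  · intro x hx
    simp only [Finset.mem_union, S₁, S₂, S₃, S₄, Finset.mem_image, Finset.mem_product,
      Finset.mem_range] at hx
    rcases hx with ((⟨p, hp, rfl⟩ | ⟨p, hp, rfl⟩) | ⟨c, hc, rfl⟩) | ⟨c, hc, rfl⟩
    · exact layer_mem_rVertices.2 ⟨hp.1, hK _ hp.2⟩
    · obtain ⟨ha, hb, -⟩ := hP' _ _ hp.1
      exact pair_mem_rVertices.2 ⟨hK _ ha, hK _ hb, hp.2⟩
    · exact left_mem_rVertices.2 hc
    · exact right_mem_rVertices.2 hc
  · rw [← c₂]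
    exact Finset.card_le_card fun x hx => by simp [hx]
  · have h1 : (S₁ ∪ S₂ ∪ S₃ ∪ S₄).card ≤ l * k + 2 * r ^ 2 * k * l + 2 * l * r + l * r * k := by
      have e1 := Finset.card_union_le (S₁ ∪ S₂ ∪ S₃) S₄
      have e2 := Finset.card_union_le (S₁ ∪ S₂) S₃
      have e3 := Finset.card_union_le S₁ S₂
      omega
    -- Each of the three other parts has at most `l * r * k` vertices, the left side because of `2 ≤
    -- k`. Allowing `4 * (l * r * k)` in all gives the round factor `r + 2`.
    have h2 : l * k ≤ l * r * k := by nlinarith [Nat.zero_le (l * k)]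
    have h3 : 2 * l * r ≤ l * r * k := by nlinarith [Nat.zero_le (l * r)]
    calc r * (S₁ ∪ S₂ ∪ S₃ ∪ S₄).card ≤
        r * (2 * r ^ 2 * k * l + 4 * (l * r * k)) := Nat.mul_le_mul_left _ (by omega)
      _ = (r + 2) * (2 * r ^ 2 * k * l) := by ring
  · let E₁ : Finset (RVertex × RVertex) :=
      (Finset.range (2 * l * r) ×ˢ Finset.range (l * r * k)).image
        fun p => (RVertex.left p.1, RVertex.right p.2)
    let E₂ : Finset (RVertex × RVertex) :=
      ((P ×ˢ Finset.range (r ^ 2 * k)) ×ˢ Finset.range l).image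
        fun p => (RVertex.pair p.1.1.1 p.1.1.2 p.1.2, RVertex.layer p.2 p.1.1.1)
    let E₃ : Finset (RVertex × RVertex) :=
      ((P ×ˢ Finset.range (r ^ 2 * k)) ×ˢ Finset.range l).image
        fun p => (RVertex.pair p.1.1.1 p.1.1.2 p.1.2, RVertex.layer p.2 p.1.1.2)
    have d₁ : E₁.card = l * (2 * r ^ 2 * k * l) := by
      rw [Finset.card_image_of_injective _ (by rintro ⟨a, b⟩ ⟨a', b'⟩ h; simpa using h)]
      simp
      ring
    have d₂ : E₂.card = l * (2 * r ^ 2 * k * l) := by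
      rw [Finset.card_image_of_injective _ (by
        rintro ⟨⟨⟨a, b⟩, j⟩, i⟩ ⟨⟨⟨a', b'⟩, j'⟩, i'⟩ h
        simp at h
        simp [h])]
      simp [hPl]
      ring
    have d₃ : E₃.card = l * (2 * r ^ 2 * k * l) := by
      rw [Finset.card_image_of_injective _ (by
        rintro ⟨⟨⟨a, b⟩, j⟩, i⟩ ⟨⟨⟨a', b'⟩, j'⟩, i'⟩ h
        simp at h
        simp [h])]
      simp [hPl]
      ring
    have h12 : Disjoint E₁ (E₂ ∪ E₃) := by
      rw [Finset.disjoint_left]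
      intro x hx hx'
      simp only [E₁, E₂, E₃, Finset.mem_union, Finset.mem_image] at hx hx'
      obtain ⟨p, -, rfl⟩ := hx
      simp at hx'
    -- The two edges from a pair into a layer differ because `A` has no loops.
    have h23 : Disjoint E₂ E₃ := by
      rw [Finset.disjoint_left]
      intro x hx hx'
      simp only [E₂, E₃, Finset.mem_image, Finset.mem_product] at hx hx'
      obtain ⟨⟨⟨⟨a, b⟩, j⟩, i⟩, hp, rfl⟩ := hx
      obtain ⟨⟨⟨⟨a', b'⟩, j'⟩, i'⟩, -, h⟩ := hx'
      simp only [Prod.mk.injEq, RVertex.pair.injEq, RVertex.layer.injEq] at h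
      obtain ⟨-, -, h⟩ := hP' _ _ hp.1.1
      grind
    have h : E₁ ∪ (E₂ ∪ E₃) ⊆ (((S₁ ∪ S₂ ∪ S₃ ∪ S₄) ×ˢ (S₁ ∪ S₂ ∪ S₃ ∪ S₄)).filter
        fun p => p.1.Rel A p.2) := by
      intro x hx
      simp only [E₁, E₂, E₃, Finset.mem_union, Finset.mem_image, Finset.mem_product,
        Finset.mem_range] at hx
      simp only [Finset.mem_filter, Finset.mem_product, Finset.mem_union]
      rcases hx with ⟨p, hp, rfl⟩ | ⟨p, hp, rfl⟩ | ⟨p, hp, rfl⟩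
      · refine ⟨⟨Or.inl (Or.inr ?_), Or.inr ?_⟩, trivial⟩
        · exact Finset.mem_image_of_mem _ (Finset.mem_range.2 hp.1)
        · exact Finset.mem_image_of_mem _ (Finset.mem_range.2 hp.2)
      · obtain ⟨ha, hb, h⟩ := hP' _ _ hp.1.1
        refine ⟨⟨Or.inl (Or.inl (Or.inr ?_)), Or.inl (Or.inl (Or.inl ?_))⟩, h, Or.inl rfl⟩
        · exact Finset.mem_image.2 ⟨p.1, by simp [hp.1.1, hp.1.2], rfl⟩
        · exact Finset.mem_image.2 ⟨(p.2, p.1.1.1), by simp [hp.2, ha], rfl⟩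
      · obtain ⟨ha, hb, h⟩ := hP' _ _ hp.1.1
        refine ⟨⟨Or.inl (Or.inl (Or.inr ?_)), Or.inl (Or.inl (Or.inl ?_))⟩, h, Or.inr rfl⟩
        · exact Finset.mem_image.2 ⟨p.1, by simp [hp.1.1, hp.1.2], rfl⟩
        · exact Finset.mem_image.2 ⟨(p.2, p.1.1.2), by simp [hp.2, hb], rfl⟩
    have h' := Finset.card_le_card h
    rw [Finset.card_union_of_disjoint h12, Finset.card_union_of_disjoint h23, d₁, d₂, d₃] at h'
    refine le_trans (by ring_nf; rfl) h'

end

/-! ### The instance of Densest At-Least-`k`-Subgraph -/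

/-- Adjacency in a graph on `Fin n`, as a relation between natural numbers. -/
def natAdj {n : ℕ} (G : SimpleGraph (Fin n)) (a b : ℕ) : Prop :=
  ∃ (ha : a < n) (hb : b < n), G.Adj ⟨a, ha⟩ ⟨b, hb⟩

theorem relCount_natAdj {n : ℕ} (G : SimpleGraph (Fin n)) (K : Finset (Fin n)) :
    relCount (natAdj G) (K.map Fin.valEmbedding) = relCount G.Adj K := by
  rw [relCount_map]
  congr
  funext x y
  simp [natAdj]

/-- The number of edges in question can be reached, and is not zero. -/
def DkSInstance.Nondegenerate (x : DkSInstance) : Prop :=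
  2 ≤ x.k ∧ 1 ≤ x.l ∧ 2 * x.l ≤ x.k * x.k

theorem maxEdgesEq_le {n : ℕ} (G : SimpleGraph (Fin n)) (k : ℕ) :
    2 * maxEdgesEq G k ≤ k * (k - 1) := by
  classical
  have h : maxEdgesEq G k ≤ k.choose 2 := by
    refine Finset.sup_le fun S hS => ?_
    have := (G.induce (S : Set (Fin n))).card_edgeFinset_le_card_choose_two
    unfold numEdges
    rw [← SimpleGraph.coe_edgeFinset, Set.ncard_coe_finset]
    refine this.trans (le_of_eq ?_)
    rw [← (Finset.mem_powersetCard.1 hS).2]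
    simp
  calc 2 * maxEdgesEq G k ≤ 2 * k.choose 2 := Nat.mul_le_mul_left _ h
    _ = k * (k - 1) := by rw [Nat.choose_two_right, Nat.mul_div_cancel' (Nat.even_mul_pred_self k).two_dvd]

/-- Consequently a degenerate instance with `1 ≤ l` may be answered `false` outright. -/
theorem DkSInstance.nondegenerate_of_le {x : DkSInstance} (hl : 1 ≤ x.l)
    (h : x.l ≤ maxEdgesEq x.G x.k) : x.Nondegenerate := by
  have h1 := maxEdgesEq_le x.G x.k
  have h2 : x.k * (x.k - 1) ≤ x.k * x.k := Nat.mul_le_mul_left _ (Nat.sub_le _ _)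
  refine ⟨?_, hl, by omega⟩
  by_contra hk
  have : x.k = 0 ∨ x.k = 1 := by omega
  rcases this with hk | hk <;> rw [hk] at h1 h <;> simp at h1 <;> omega

open Classical in
/-- The instance of Densest At-Least-`k`-Subgraph for an instance of the gap problem. -/
def reduction (r : ℕ) (hr : 0 < r) (x : DkSInstance) : DALkSInstance :=
  if h : x.Nondegenerate then
    { n := (rVertices x.n x.l (r ^ 2 * x.k) (2 * x.l * r) (x.l * r * x.k)).length
      G := rGraph (natAdj x.G) _ _ _ _ _
      k := 2 * r ^ 2 * x.k * x.l
      k_pos := by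
        obtain ⟨h1, h2, -⟩ := h
        have : 0 < x.k := by omega
        exact Nat.succ_le_of_lt (by positivity)
      k_le := by
        obtain ⟨h1, h2, h3⟩ := h
        have h4 : x.k * x.k ≤ x.n * x.n := Nat.mul_le_mul x.k_le x.k_le
        have h5 : 2 * x.l * (r ^ 2 * x.k) ≤ x.n * x.n * (r ^ 2 * x.k) :=
          Nat.mul_le_mul_right _ (by omega)
        have h6 : 2 * r ^ 2 * x.k * x.l = 2 * x.l * (r ^ 2 * x.k) := by ring
        rw [length_rVertices, ← mul_assoc x.n x.n, h6]
        omega }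
  else ⟨1, ⊥, 1, le_rfl, le_rfl⟩

/-- The bound depends on `k` only, because nondegeneracy limits `l` by $k^2/2$; the parameterized
statement rests on this. The summand 2 covers the trivial instance. -/
theorem param_reduction_lt {r : ℕ} (hr : 0 < r) (x : DkSInstance) :
    (reduction r hr x).k < r ^ 2 * x.k * (x.k * x.k) + 2 := by
  unfold reduction
  split_ifs with h
  · obtain ⟨h1, h2, h3⟩ := h
    have h4 : r ^ 2 * x.k * (2 * x.l) ≤ r ^ 2 * x.k * (x.k * x.k) := Nat.mul_le_mul_left _ h3
    have h5 : 2 * r ^ 2 * x.k * x.l = r ^ 2 * x.k * (2 * x.l) := by ring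
    show 2 * r ^ 2 * x.k * x.l < _
    omega
  · show 1 < _
    omega

/-- A layer that certifies that the given graph has a dense subgraph. -/
def GoodLayer (r : ℕ) (x : DkSInstance) (T : Finset ℕ) : Prop :=
  T.card ≤ 2 * r ^ 4 * x.k ∧ x.l ≤ r * relCount (natAdj x.G) T

/-- The set is cut into `6 * r ^ 4` blocks of at most `k / 2` vertices, and $72r^9 =
r\cdot(6r^4)^2\cdot 2$. Nothing is assumed about where `T` comes from, so a positive verdict is
sound for any answer. -/
theorem GoodLayer.le_maxEdgesEq {r : ℕ} {x : DkSInstance} {T : Finset ℕ}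
    (hx : x.Nondegenerate) (hT : ∀ u ∈ T, u < x.n) (h : GoodLayer r x T) :
    x.l ≤ 72 * r ^ 9 * maxEdgesEq x.G x.k := by
  classical
  obtain ⟨T', hT'⟩ : ∃ T' : Finset (Fin x.n), T'.map Fin.valEmbedding = T := by
    refine ⟨Finset.univ.filter fun u => (u : ℕ) ∈ T, ?_⟩
    ext u
    simp only [Finset.mem_map, Finset.mem_filter, Finset.mem_univ, true_and,
      Fin.valEmbedding_apply]
    exact ⟨fun ⟨v, hv, e⟩ => e ▸ hv, fun hu => ⟨⟨u, hT u hu⟩, hu, rfl⟩⟩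
  obtain ⟨h1, h2⟩ := h
  rw [← hT', relCount_natAdj] at h2
  rw [← hT', Finset.card_map] at h1
  have hk := hx.1
  have h3 := relCount_adj_le_mul_maxEdgesEq x.G (h := x.k / 2) (B := 6 * r ^ 4) x.k_le
    (by omega) (by omega) (S := T') (by
      -- The division rounds down, which for `2 ≤ x.k` costs at most the factor `3 / 2`.
      have : x.k ≤ 3 * (x.k / 2) := by omega
      calc T'.card ≤ 2 * r ^ 4 * x.k := h1
        _ ≤ 2 * r ^ 4 * (3 * (x.k / 2)) := Nat.mul_le_mul_left _ this
        _ = 6 * r ^ 4 * (x.k / 2) := by ring)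
  calc x.l ≤ r * relCount x.G.Adj T' := h2
    _ ≤ r * (6 * r ^ 4 * (6 * r ^ 4) * (2 * maxEdgesEq x.G x.k)) := Nat.mul_le_mul_left _ h3
    _ = 72 * r ^ 9 * maxEdgesEq x.G x.k := by ring

theorem graphDensity_le_maxDensityGe {n : ℕ} (G : SimpleGraph (Fin n)) {k : ℕ}
    {S : Finset (Fin n)} (hS : k ≤ S.card) :
    graphDensity (G.induce (S : Set (Fin n))) ≤ maxDensityGe G k :=
  le_ciSup (f := fun S : {S : Finset (Fin n) // k ≤ S.card} =>
    graphDensity (G.induce ((S : Finset (Fin n)) : Set (Fin n)))) (Set.finite_range _).bddAbove ⟨S, hS⟩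

/-- The optimum is at least $3lr/(r+2)$ by `exists_dense_set`, while an answer without a good layer
has density at most $(2r+2)l/r$ by `exists_dense_layer`; `hρ'` says that the quotient exceeds
`rho'`. The nonnegative `rho'` is there because `rho` may be negative. -/
theorem exists_goodLayer {r : ℕ} (hr : 0 < r) {x : DkSInstance} (hx : x.Nondegenerate)
    (hl : x.l ≤ maxEdgesEq x.G x.k) {rho rho' : ℝ} (hρ : rho ≤ rho') (hρ₁ : 0 ≤ rho')
    (hρ' : rho' * ((2 * r + 2) * (r + 2)) < 3 * r ^ 2)
    {S : Finset (Fin (rVertices x.n x.l (r ^ 2 * x.k) (2 * x.l * r) (x.l * r * x.k)).length)}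
    (hS : 2 * r ^ 2 * x.k * x.l ≤ S.card)
    (hd : maxDensityGe (rGraph (natAdj x.G) x.n x.l (r ^ 2 * x.k) (2 * x.l * r) (x.l * r * x.k))
      (2 * r ^ 2 * x.k * x.l) ≤ rho * graphDensity
        ((rGraph (natAdj x.G) x.n x.l (r ^ 2 * x.k) (2 * x.l * r) (x.l * r * x.k)).induce
          (S : Set _))) :
    ∃ i < x.l, GoodLayer r x (layerSet x.n (S.map (rEmb _ _ _ _ _)) i) := by
  have hne : ((Finset.univ : Finset (Fin x.n)).powersetCard x.k).Nonempty :=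
    Finset.powersetCard_nonempty.2 (by simpa using x.k_le)
  obtain ⟨K, hK, hKl⟩ := Finset.exists_mem_eq_sup _ hne
    fun S : Finset (Fin x.n) => numEdges (x.G.induce (S : Set (Fin x.n)))
  have hKk := (Finset.mem_powersetCard.1 hK).2
  have h1 : 2 * x.l ≤ relCount (natAdj x.G) (K.map Fin.valEmbedding) := by
    rw [relCount_natAdj, relCount_adj, ← hKl]
    exact Nat.mul_le_mul_left _ hl
  obtain ⟨S₀, h2, h3, h4, h5⟩ := exists_dense_set (n := x.n)
    (A := natAdj x.G) (fun a ⟨_, _, h⟩ => x.G.loopless.irrefl _ h)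
    hx.1 hr (K := K.map Fin.valEmbedding) (by simp) (by simpa using hKk) h1
  obtain ⟨S₁, rfl⟩ := exists_map_rEmb h2
  rw [Finset.card_map] at h3
  have h6 := (graphDensity_le_maxDensityGe _ h3).trans hd
  rw [graphDensity_rGraph, graphDensity_rGraph] at h6
  refine exists_dense_layer (natAdj x.G) hr (S := S.map (rEmb _ _ _ _ _)) ?_ (by simpa using hS) ?_
  · intro y hy
    obtain ⟨z, -, rfl⟩ := Finset.mem_map.1 hy
    exact List.get_mem _ _
  by_contra hcon
  rw [not_lt] at hcon
  have hm : 0 < 2 * r ^ 2 * x.k * x.l := by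
    obtain ⟨h1, h2, -⟩ := hx
    have : 0 < x.k := by omega
    positivity
  simp only [Finset.card_map] at h4 h6 hcon
  set E := relCount (RVertex.Rel (natAdj x.G)) (S.map (rEmb _ _ _ _ _))
  set E₁ := relCount (RVertex.Rel (natAdj x.G)) (S₁.map (rEmb _ _ _ _ _))
  set m := 2 * r ^ 2 * x.k * x.l
  have hs : (0 : ℝ) < S.card := by exact_mod_cast lt_of_lt_of_le hm hS
  have hs₁ : (0 : ℝ) < S₁.card := by exact_mod_cast lt_of_lt_of_le hm h3
  have hr' : (0 : ℝ) < r := by exact_mod_cast hr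
  have hl' : (0 : ℝ) < x.l := by exact_mod_cast hx.2.1
  have hm' : (0 : ℝ) < m := by exact_mod_cast hm
  have c1 : (r : ℝ) * E ≤ (2 * r + 2) * x.l * S.card := by exact_mod_cast hcon
  have c2 : (r : ℝ) * S₁.card ≤ (r + 2) * m := by exact_mod_cast h4
  have c3 : (3 : ℝ) * x.l * m ≤ E₁ := by exact_mod_cast h5
  have c4 : (E : ℝ) / S.card ≤ (2 * r + 2) * x.l / r := by
    rw [div_le_div_iff₀ hs hr']
    linarith
  have c5 : (3 : ℝ) * x.l * r / (r + 2) ≤ E₁ / S₁.card := by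
    rw [div_le_div_iff₀ (by positivity) hs₁]
    calc (3 : ℝ) * x.l * r * S₁.card = 3 * x.l * (r * S₁.card) := by ring
      _ ≤ 3 * x.l * ((r + 2) * m) := by gcongr
      _ = 3 * x.l * m * (r + 2) := by ring
      _ ≤ E₁ * (r + 2) := by gcongr
  have c6 : rho * ((E : ℝ) / S.card) ≤ rho' * ((2 * r + 2) * x.l / r) :=
    (mul_le_mul_of_nonneg_right hρ (by positivity)).trans (mul_le_mul_of_nonneg_left c4 hρ₁)
  have c7 := c5.trans (h6.trans c6)
  rw [← mul_div_assoc, div_le_div_iff₀ (by positivity) hr'] at c7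
  have c8 : rho' * ((2 * r + 2) * (r + 2)) * x.l < 3 * r ^ 2 * x.l :=
    mul_lt_mul_of_pos_right hρ' hl'
  nlinarith

/-- The left side is $2\rho r^2+\rho(6r+4)$, and $\rho(6r+4)\le 15r<(3-2\rho)r^2$ by the choice of
`r`. -/
theorem exists_reduction_constant {rho : ℝ} (h : rho < 3 / 2) :
    ∃ r : ℕ, 0 < r ∧ rho * ((2 * r + 2) * (r + 2)) < 3 * (r : ℝ) ^ 2 := by
  obtain ⟨r, hr⟩ := exists_nat_gt (max 1 (15 / (3 - 2 * rho)))
  have h1 : (1 : ℝ) < r := lt_of_le_of_lt (le_max_left _ _) hr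
  have h2 : 15 / (3 - 2 * rho) < r := lt_of_le_of_lt (le_max_right _ _) hr
  rw [div_lt_iff₀ (by linarith)] at h2
  refine ⟨r, by exact_mod_cast (by linarith : (0 : ℝ) < r), ?_⟩
  have h3 : rho * (6 * r + 4) ≤ 3 / 2 * (10 * r) := by nlinarith
  nlinarith

/-! ### Computing the reduction -/

/-- The input word for an instance of the gap problem. -/
def DkSInstance.word (x : DkSInstance) : List (Option Bool) :=
  encodeNumber x.k ++ encodeNumber x.l ++ encodeGraph x.G

open Classical in
theorem DkSInstance.word_eq (x : DkSInstance) :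
    x.word = ((Computability.encodeNat x.k :: Computability.encodeNat x.l ::
      (List.finRange x.n).map fun u => (List.finRange x.n).map fun v => decide (x.G.Adj u v)) :
        List (List Bool)).flatMap fun l => l.map some ++ [none] := by
  simp [word, encodeNumber, encodeGraph, List.flatMap_map, Function.comp_def]

theorem DkSInstance.segment_word_zero (x : DkSInstance) :
    wordSegment 0 x.word = (Computability.encodeNat x.k).map some := by
  rw [word_eq, segment_flatMap]
  rfl

theorem DkSInstance.segment_word_one (x : DkSInstance) :
    wordSegment 1 x.word = (Computability.encodeNat x.l).map some := by
  rw [word_eq, segment_flatMap]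
  rfl

/-- The input does not contain the number of vertices; it is read off the first row of the matrix.
If there is no row, the default value has the right length zero. -/
theorem DkSInstance.length_segment_word_two (x : DkSInstance) :
    (wordSegment 2 x.word).length = x.n := by
  rw [word_eq, segment_flatMap]
  simp only [List.getD_cons_succ, List.length_map]
  obtain ⟨n, G, k, l, h⟩ := x
  cases n <;> simp [List.finRange_succ]

theorem DkSInstance.segment_word_getElem? (x : DkSInstance) (a b : ℕ) :
    (wordSegment (a + 2) x.word)[b]? = some (some true) ↔ natAdj x.G a b := by
  rw [word_eq, segment_flatMap]
  simp only [List.getD_cons_succ, natAdj]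
  by_cases ha : a < x.n
  · by_cases hb : b < x.n
    · simp [ha, hb, List.getD_eq_getElem?_getD]
    · simp [ha, hb, List.getD_eq_getElem?_getD]
  · simp [ha, List.getD_eq_getElem?_getD]

section

variable {Γ Δ : Type} {V : Set (Γ → List (Option Bool))} {W : Set (Δ → List (Option Bool))}
  {x : Γ → DkSInstance}

/-- Unary notation may be exponentially longer than binary, so a bound `n` is needed: every number
up to `n` is converted to binary and compared, and at most one of them contributes to the sum. -/
theorem CompN.of_encodeNat {F : Γ → List (Option Bool)} {m n : Γ → ℕ} (hF : Comp V F)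
    (hn : CompN V n) (h : ∀ γ, F γ = (Computability.encodeNat (m γ)).map some) :
    CompN V fun γ => if m γ ≤ n γ then m γ else 0 := by
  have h1 : CompN (extNat V) fun p => if decide ((Computability.encodeNat p.2).map some = F p.1) = true
      then p.2 else 0 :=
    CompN.ite (CompB.of_eq ((Comp.bin CompN.index).congr fun p => by simp [unary]) hF.up)
      CompN.index (CompN.const 0)
  refine ((hn.add (CompN.const 1)).sum_range h1).congr fun γ => ?_
  have h2 : ∀ i, ((Computability.encodeNat i).map some = F γ) ↔ i = m γ := by
    intro i
    rw [h, List.map_inj_right (fun _ _ => Option.some.inj), encodeNat_injective.eq_iff]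
  simp only [h2, decide_eq_true_eq, Finset.sum_ite_eq', Finset.mem_range, Nat.lt_succ_iff]

theorem CompN.instance_n (hx : Comp V fun γ => (x γ).word) : CompN V fun γ => (x γ).n :=
  (Comp.unary_length (hx.segment (CompN.const 2))).congr fun γ =>
    (x γ).length_segment_word_two

theorem CompN.instance_k (hx : Comp V fun γ => (x γ).word) : CompN V fun γ => (x γ).k :=
  (CompN.of_encodeNat (hx.segment (CompN.const 0)) (CompN.instance_n hx) fun γ =>
    (x γ).segment_word_zero).congr fun γ => if_pos (x γ).k_le

/-- The number of edges in question, or zero if it is too large. -/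
def DkSInstance.cappedL (x : DkSInstance) : ℕ := if x.l ≤ x.k * x.k then x.l else 0

/-- The number `l` itself may be exponential in the input length; the cap loses nothing on
nondegenerate instances. -/
theorem CompN.instance_cappedL (hx : Comp V fun γ => (x γ).word) :
    CompN V fun γ => (x γ).cappedL :=
  CompN.of_encodeNat (hx.segment (CompN.const 1))
    ((CompN.instance_k hx).mul (CompN.instance_k hx)) fun γ => (x γ).segment_word_one

theorem DkSInstance.Nondegenerate.cappedL_eq {x : DkSInstance} (h : x.Nondegenerate) :
    x.cappedL = x.l := if_pos (by have := h.2.2; omega)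

theorem DkSInstance.nondegenerate_iff (x : DkSInstance) :
    x.Nondegenerate ↔ 2 ≤ x.k ∧ 1 ≤ x.cappedL ∧ 2 * x.cappedL ≤ x.k * x.k := by
  unfold Nondegenerate cappedL
  split_ifs with h
  · rfl
  · omega

open Classical in
theorem CompB.instance_nondegenerate (hx : Comp V fun γ => (x γ).word) :
    CompB V fun γ => decide (x γ).Nondegenerate := by
  have hk := CompN.instance_k hx
  have hl := CompN.instance_cappedL hx
  refine ((CompB.leNat (CompN.const 2) hk).and ((CompB.leNat (CompN.const 1) hl).and
    (CompB.leNat ((CompN.const 2).mul hl) (hk.mul hk)))).congr fun γ => ?_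
  rw [Bool.eq_iff_iff]
  simp only [Bool.and_eq_true, decide_eq_true_eq]
  exact (x γ).nondegenerate_iff.symm

open Classical in
theorem CompB.instance_natAdj (hx : Comp V fun γ => (x γ).word) {a b : Γ → ℕ} (ha : CompN V a)
    (hb : CompN V b) : CompB V fun γ => decide (natAdj (x γ).G (a γ) (b γ)) :=
  (CompB.getElem? (hx.segment (ha.add (CompN.const 2))) hb).congr fun γ => by
    rw [Bool.eq_iff_iff]
    simp only [decide_eq_true_eq]
    exact (x γ).segment_word_getElem? _ _

/-- The vertex `v γ` of the graph of the reduction can be computed in polynomial time. -/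
def CompV (V : Set (Γ → List (Option Bool))) (v : Γ → RVertex) : Prop :=
  (∃ i u, CompN V i ∧ CompN V u ∧ ∀ γ, v γ = RVertex.layer (i γ) (u γ)) ∨
  (∃ a b j, CompN V a ∧ CompN V b ∧ CompN V j ∧ ∀ γ, v γ = RVertex.pair (a γ) (b γ) (j γ)) ∨
  (∃ c, CompN V c ∧ ∀ γ, v γ = RVertex.left (c γ)) ∨
  (∃ c, CompN V c ∧ ∀ γ, v γ = RVertex.right (c γ))

theorem CompV.comap (g : Δ → Γ) (hg : ∀ v ∈ V, v ∘ g ∈ W) {v : Γ → RVertex} (hv : CompV V v) :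
    CompV W fun δ => v (g δ) := by
  rcases hv with ⟨i, u, hi, hu, h⟩ | ⟨a, b, j, ha, hb, hj, h⟩ | ⟨c, hc, h⟩ | ⟨c, hc, h⟩
  · exact Or.inl ⟨_, _, Comp.comap g hg hi, Comp.comap g hg hu, fun _ => h _⟩
  · exact Or.inr (Or.inl ⟨_, _, _, Comp.comap g hg ha, Comp.comap g hg hb, Comp.comap g hg hj,
      fun _ => h _⟩)
  · exact Or.inr (Or.inr (Or.inl ⟨_, Comp.comap g hg hc, fun _ => h _⟩))
  · exact Or.inr (Or.inr (Or.inr ⟨_, Comp.comap g hg hc, fun _ => h _⟩))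

theorem comp_fst_mem_extNat {v : Γ → List (Option Bool)} (hv : v ∈ V) :
    v ∘ Prod.fst ∈ extNat V :=
  Set.mem_insert_of_mem _ (Set.mem_image_of_mem _ hv)

/-- The hypothesis on `g` ranges over all contexts because up to three nested loops add their
indices to the variables before `g` is evaluated. -/
theorem Comp.flatMap_rVertices {n w M q₁ q₂ : Γ → ℕ} (hn : CompN V n) (hw : CompN V w)
    (hM : CompN V M) (h₁ : CompN V q₁) (h₂ : CompN V q₂) {g : Γ → RVertex → List (Option Bool)}
    (hg : ∀ {Δ : Type} {W : Set (Δ → List (Option Bool))} (φ : Δ → Γ),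
      (∀ v ∈ V, v ∘ φ ∈ W) → ∀ {v : Δ → RVertex}, CompV W v → Comp W fun δ => g (φ δ) (v δ)) :
    Comp V fun γ => (rVertices (n γ) (w γ) (M γ) (q₁ γ) (q₂ γ)).flatMap (g γ) := by
  have c1 : CompN (extNat (extNat V)) fun p => p.1.2 := CompN.index.up
  have c2 : CompN (extNat (extNat (extNat V))) fun p => p.1.1.2 := c1.up
  have c3 : CompN (extNat (extNat (extNat V))) fun p => p.1.2 := CompN.index.up
  have m1 : ∀ v ∈ V, v ∘ Prod.fst ∈ extNat V := fun v hv => comp_fst_mem_extNat hv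
  have m2 : ∀ v ∈ V, v ∘ (Prod.fst ∘ Prod.fst) ∈ extNat (extNat V) := fun v hv =>
    comp_fst_mem_extNat (m1 v hv)
  have m3 : ∀ v ∈ V, v ∘ (Prod.fst ∘ Prod.fst ∘ Prod.fst) ∈ extNat (extNat (extNat V)) :=
    fun v hv => comp_fst_mem_extNat (m2 v hv)
  have a1 := flatMapRange hw (flatMapRange hn.up (hg (Prod.fst ∘ Prod.fst) m2
    (Or.inl ⟨_, _, c1, CompN.index, fun _ => rfl⟩)))
  have a2 := flatMapRange hn (flatMapRange hn.up (flatMapRange hM.up.up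
    (hg (Prod.fst ∘ Prod.fst ∘ Prod.fst) m3
      (Or.inr (Or.inl ⟨_, _, _, c2, c3, CompN.index, fun _ => rfl⟩)))))
  have a3 := flatMapRange h₁ (hg Prod.fst m1
    (Or.inr (Or.inr (Or.inl ⟨_, CompN.index, fun _ => rfl⟩))))
  have a4 := flatMapRange h₂ (hg Prod.fst m1
    (Or.inr (Or.inr (Or.inr ⟨_, CompN.index, fun _ => rfl⟩))))
  refine (a1.append (a2.append (a3.append a4))).congr fun γ => ?_
  simp [rVertices, List.flatMap_assoc, List.flatMap_map]

open Classical in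
-- The kinds of both vertices are fixed, and the relation is constant except between a pair and a
-- layer.
theorem CompB.rel (hx : Comp V fun γ => (x γ).word) {v v' : Γ → RVertex} (hv : CompV V v)
    (hv' : CompV V v') : CompB V fun γ => decide ((v γ).Rel (natAdj (x γ).G) (v' γ)) := by
  rcases hv with ⟨i, u, hi, hu, h⟩ | ⟨a, b, j, ha, hb, hj, h⟩ | ⟨c, hc, h⟩ | ⟨c, hc, h⟩ <;>
  rcases hv' with ⟨i', u', hi', hu', h'⟩ | ⟨a', b', j', ha', hb', hj', h'⟩ | ⟨c', hc', h'⟩ |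
    ⟨c', hc', h'⟩ <;> simp only [h, h', RVertex.Rel, decide_false, decide_true]
  case inr.inl.inl =>
    exact ((CompB.instance_natAdj hx ha hb).and
      ((CompB.eqNat hu' ha).or (CompB.eqNat hu' hb))).congr fun γ => by simp
  all_goals exact CompB.const _

open Classical in
theorem encodeGraph_rGraph (A : ℕ → ℕ → Prop) (n w M q₁ q₂ : ℕ) :
    encodeGraph (rGraph A n w M q₁ q₂) = (rVertices n w M q₁ q₂).flatMap fun u =>
      ((rVertices n w M q₁ q₂).flatMap fun v => [some (decide (u.Rel A v) || decide (v.Rel A u))])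
        ++ [none] := by
  have h : ∀ {α β : Type} (l : List α) (f : α → β),
      (List.finRange l.length).map (fun i => f (l.get i)) = l.map f := fun l f => by
    conv_rhs => rw [← List.map_get_finRange l, List.map_map]
    rfl
  unfold encodeGraph
  have e : ∀ u : Fin (rVertices n w M q₁ q₂).length,
      (List.finRange _).map (fun v => some (decide ((rGraph A n w M q₁ q₂).Adj u v))) =
        (rVertices n w M q₁ q₂).map fun v =>
          some (decide (((rVertices n w M q₁ q₂).get u).Rel A v) ||
            decide (v.Rel A ((rVertices n w M q₁ q₂).get u))) := by
    intro u
    rw [← h (rVertices n w M q₁ q₂)]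
    refine List.map_congr_left fun v _ => ?_
    rw [Option.some_inj, Bool.eq_iff_iff, Bool.or_eq_true, decide_eq_true_iff, decide_eq_true_iff,
      decide_eq_true_iff]
    rfl
  simp only [e, ← List.map_eq_flatMap]
  rw [List.flatMap_def, List.flatMap_def, ← h (rVertices n w M q₁ q₂)]

/-- The input word for the constructed instance of Densest At-Least-`k`-Subgraph. -/
def reductionWord (r : ℕ) (hr : 0 < r) (x : DkSInstance) : List (Option Bool) :=
  encodeNumber (reduction r hr x).k ++ encodeGraph (reduction r hr x).G

theorem reductionWord_eq {r : ℕ} (hr : 0 < r) {x : DkSInstance} (h : x.Nondegenerate) :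
    reductionWord r hr x = encodeNumber (2 * r ^ 2 * x.k * x.l) ++ encodeGraph
      (rGraph (natAdj x.G) x.n x.l (r ^ 2 * x.k) (2 * x.l * r) (x.l * r * x.k)) := by
  unfold reductionWord
  rw [reduction, dif_pos h]

open Classical in
-- The graph is written with `cappedL` in place of `l`, which keeps the loops polynomial; for
-- degenerate instances that output is discarded in favour of a constant.
theorem Comp.reductionWord (r : ℕ) (hr : 0 < r) (hx : Comp V fun γ => (x γ).word) :
    Comp V fun γ => reductionWord r hr (x γ) := by
  have hn := CompN.instance_n hx
  have hk := CompN.instance_k hx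
  have hl := CompN.instance_cappedL hx
  have hM := (CompN.const (r ^ 2)).mul hk
  have h₁ := ((CompN.const 2).mul hl).mul (CompN.const r)
  have h₂ := (hl.mul (CompN.const r)).mul hk
  have hg := Comp.flatMap_rVertices hn hl hM h₁ h₂ (g := fun γ u =>
    ((rVertices (x γ).n (x γ).cappedL (r ^ 2 * (x γ).k) (2 * (x γ).cappedL * r)
      ((x γ).cappedL * r * (x γ).k)).flatMap fun v =>
        [some (decide (u.Rel (natAdj (x γ).G) v) || decide (v.Rel (natAdj (x γ).G) u))]) ++ [none])
    fun φ hφ v hv => (Comp.flatMap_rVertices (hn.comap φ hφ) (hl.comap φ hφ) (hM.comap φ hφ)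
      (h₁.comap φ hφ) (h₂.comap φ hφ) (g := fun δ v' => [some
        (decide ((v δ).Rel (natAdj (x (φ δ)).G) v') || decide (v'.Rel (natAdj (x (φ δ)).G) (v δ)))])
      fun ψ hψ v' hv' =>
        have hx' := (hx.comap φ hφ).comap ψ hψ
        (CompB.rel hx' (hv.comap ψ hψ) hv').or (CompB.rel hx' hv' (hv.comap ψ hψ))).append
          (Comp.const [none])
  have hb := (Comp.bin ((((CompN.const 2).mul (CompN.const (r ^ 2))).mul hk).mul hl)).append
    ((Comp.const [none]).append hg)
  refine ((CompB.instance_nondegenerate hx).ite hb (Comp.const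
    (encodeNumber 1 ++ encodeGraph (⊥ : SimpleGraph (Fin 1))))).congr fun γ => ?_
  by_cases h : (x γ).Nondegenerate
  · rw [reductionWord_eq hr h, encodeGraph_rGraph, h.cappedL_eq, decide_eq_true h, if_pos rfl]
    simp [encodeNumber, unary, h.cappedL_eq]
  · rw [decide_eq_false h, if_neg (by simp), _root_.reductionWord, reduction, dif_neg h]

end

/-! ### Evaluating the answer -/

/-- The layers come first in the list, so their part of an answer can be located by simple
arithmetic. -/
theorem rVertices_getElem?_layer {n w M q₁ q₂ i u : ℕ} (hi : i < w) (hu : u < n) :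
    (rVertices n w M q₁ q₂)[i * n + u]? = some (RVertex.layer i u) := by
  have hl : ∀ w, ((List.range w).flatMap fun i => (List.range n).map fun u =>
      RVertex.layer i u).length = w * n := by simp
  have h : i * n + u < w * n :=
    calc i * n + u < i * n + n := by omega
      _ = (i + 1) * n := by ring
      _ ≤ w * n := Nat.mul_le_mul_right _ hi
  rw [rVertices, List.getElem?_append_left (by rw [hl]; exact h)]
  clear h
  induction w with
  | zero => omega
  | succ w ih =>
    rw [List.range_succ, List.flatMap_append]
    rcases Nat.lt_succ_iff_lt_or_eq.1 hi with h | rfl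
    · rw [List.getElem?_append_left, ih h]
      rw [hl]
      calc i * n + u < i * n + n := by omega
        _ = (i + 1) * n := by ring
        _ ≤ w * n := Nat.mul_le_mul_right _ h
    · rw [List.getElem?_append_right (by rw [hl]; omega), hl]
      simp [hu]

/-- The part in layer `i` of the vertex set with characteristic vector `w`. -/
def answerLayer (n : ℕ) (w : List Bool) (i : ℕ) : Finset ℕ :=
  (Finset.range n).filter fun u => w[i * n + u]? = some true

theorem answerLayer_encodeVertexSet {n w M q₁ q₂ i : ℕ}
    (S : Finset (Fin (rVertices n w M q₁ q₂).length)) (hi : i < w) :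
    answerLayer n (encodeVertexSet S) i = layerSet n (S.map (rEmb n w M q₁ q₂)) i := by
  classical
  refine Finset.filter_congr fun u hu => ?_
  have h := rVertices_getElem?_layer (M := M) (q₁ := q₁) (q₂ := q₂) hi (Finset.mem_range.1 hu)
  obtain ⟨hlt, hj⟩ := List.getElem?_eq_some_iff.1 h
  have e : RVertex.layer i u = rEmb n w M q₁ q₂ ⟨i * n + u, hlt⟩ := hj.symm
  rw [e, Finset.mem_map']
  simp [encodeVertexSet, hlt]

open Classical in
/-- The answer to an instance of the gap problem that is derived from the answer `w` to the
constructed instance of Densest At-Least-`k`-Subgraph. -/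
def verdict (r : ℕ) (x : DkSInstance) (w : List Bool) : Bool :=
  decide (x.l = 0) ||
    (decide x.Nondegenerate && decide (∃ i < x.l, GoodLayer r x (answerLayer x.n w i)))

section

variable {Γ : Type} {V : Set (Γ → List (Option Bool))} {x : Γ → DkSInstance} {w : Γ → List Bool}

theorem CompB.mem_answerLayer (hx : Comp V fun γ => (x γ).word)
    (hw : Comp V fun γ => (w γ).map some) {i u : Γ → ℕ} (hi : CompN V i) (hu : CompN V u) :
    CompB V fun γ => decide ((w γ)[i γ * (x γ).n + u γ]? = some true) :=
  (CompB.getElem? hw ((hi.mul (CompN.instance_n hx)).add hu)).congr fun γ => by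
    simp

open Classical in
theorem CompB.goodLayer (r : ℕ) (hx : Comp V fun γ => (x γ).word)
    (hw : Comp V fun γ => (w γ).map some) {i : Γ → ℕ} (hi : CompN V i) :
    CompB V fun γ => decide ((answerLayer (x γ).n (w γ) (i γ)).card ≤ 2 * r ^ 4 * (x γ).k ∧
      (x γ).cappedL ≤ r * relCount (natAdj (x γ).G) (answerLayer (x γ).n (w γ) (i γ))) := by
  have hn := CompN.instance_n hx
  have h1 : CompN V fun γ => (answerLayer (x γ).n (w γ) (i γ)).card :=
    (hn.sum_range (CompN.ite (CompB.mem_answerLayer hx.up hw.up hi.up CompN.index)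
      (CompN.const 1) (CompN.const 0))).congr fun γ => by
      rw [answerLayer, Finset.card_filter]
      simp only [decide_eq_true_eq]
  have h2 : CompN V fun γ => relCount (natAdj (x γ).G) (answerLayer (x γ).n (w γ) (i γ)) :=
    (hn.sum_range (hn.up.sum_range (CompN.ite
      (((CompB.mem_answerLayer hx.up.up hw.up.up hi.up.up CompN.index.up).and
        (CompB.mem_answerLayer hx.up.up hw.up.up hi.up.up CompN.index)).and
        (CompB.instance_natAdj hx.up.up CompN.index.up CompN.index))
      (CompN.const 1) (CompN.const 0)))).congr fun γ => by
      rw [relCount, Finset.card_filter, Finset.sum_product]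
      simp only [answerLayer, Finset.sum_filter, Bool.and_eq_true, decide_eq_true_eq, ite_and]
      refine Finset.sum_congr rfl fun a _ => ?_
      split_ifs with h <;> simp
  refine ((CompB.leNat h1 ((CompN.const (2 * r ^ 4)).mul (CompN.instance_k hx))).and
    (CompB.leNat (CompN.instance_cappedL hx) ((CompN.const r).mul h2))).congr fun γ => ?_
  simp

open Classical in
theorem CompB.verdict (r : ℕ) (hx : Comp V fun γ => (x γ).word)
    (hw : Comp V fun γ => (w γ).map some) : CompB V fun γ => verdict r (x γ) (w γ) := by
  have hl := CompN.instance_cappedL hx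
  -- Whether `l` is zero is tested on its binary word, which is then empty; `cappedL` also vanishes
  -- when `l` is too large.
  refine ((CompB.of_eq (hx.segment (CompN.const 1)) (Comp.const [])).or
    ((CompB.instance_nondegenerate hx).and (CompB.exists_lt hl
      (CompB.goodLayer r hx.up hw.up CompN.index)))).congr fun γ => ?_
  have h0 : wordSegment 1 (x γ).word = [] ↔ (x γ).l = 0 := by
    rw [(x γ).segment_word_one, List.map_eq_nil_iff, ← encodeNat_zero, encodeNat_injective.eq_iff]
  rw [Bool.eq_iff_iff]
  simp only [h0, _root_.verdict, Bool.or_eq_true, Bool.and_eq_true, decide_eq_true_eq]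
  refine or_congr_right (and_congr_right fun h => ?_)
  rw [h.cappedL_eq]
  rfl

end

/-- The answer is correct for graphs with many edges on some `k` vertices. -/
theorem verdict_eq_true {r : ℕ} (hr : 0 < r) {x : DkSInstance} (hl : x.l ≤ maxEdgesEq x.G x.k)
    {rho rho' : ℝ} (hρ : rho ≤ rho') (hρ₁ : 0 ≤ rho')
    (hρ' : rho' * ((2 * r + 2) * (r + 2)) < 3 * r ^ 2) {w : List Bool}
    (hw : (ApproxDALkS rho).Accepts (reduction r hr x) w) : verdict r x w = true := by
  classical
  unfold verdict
  by_cases hl₀ : x.l = 0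
  · simp [hl₀]
  have hx := DkSInstance.nondegenerate_of_le (Nat.one_le_iff_ne_zero.2 hl₀) hl
  rw [reduction, dif_pos hx] at hw
  obtain ⟨S, rfl, hS, hd⟩ := hw
  obtain ⟨i, hi, hg⟩ := exists_goodLayer hr hx hl hρ hρ₁ hρ' hS hd
  rw [← answerLayer_encodeVertexSet S hi] at hg
  simp only [Bool.or_eq_true, Bool.and_eq_true, decide_eq_true_eq]
  exact Or.inr ⟨hx, i, hi, hg⟩

/-- The answer is correct for graphs with few edges on all sets of `k` vertices. -/
theorem verdict_eq_false {r : ℕ} (hr : 0 < r) {x : DkSInstance} {w : List Bool}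
    (h : (maxEdgesEq x.G x.k : ℝ) < x.l / (72 * r ^ 9 : ℕ)) : verdict r x w = false := by
  classical
  rw [Bool.eq_false_iff]
  intro hv
  have hr' : (0 : ℝ) < (72 * r ^ 9 : ℕ) := by exact_mod_cast (by positivity : 0 < 72 * r ^ 9)
  rw [lt_div_iff₀ hr'] at h
  have h' : maxEdgesEq x.G x.k * (72 * r ^ 9) < x.l := by exact_mod_cast h
  simp only [verdict, Bool.or_eq_true, Bool.and_eq_true, decide_eq_true_eq] at hv
  rcases hv with hv | ⟨hx, i, -, hg⟩
  · omega
  · have := hg.le_maxEdgesEq hx fun u hu => Finset.mem_range.1 (Finset.mem_filter.1 hu).1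
    rw [mul_comm] at h'
    omega

/-! ### Reductions with one query -/

namespace CompProblem

theorem SolvableInTime.mono {P : CompProblem} {T T' : P.Inst → ℕ} (h : P.SolvableInTime T)
    (hT : ∀ x, T x ≤ T' x) : P.SolvableInTime T' := by
  obtain ⟨M, hM⟩ := h
  refine ⟨M, fun x => ?_⟩
  obtain ⟨w, hw, ⟨⟨e, he⟩⟩⟩ := hM x
  exact ⟨w, hw, ⟨⟨e, he.trans (hT x)⟩⟩⟩

/-- Stack `0` holds the input, stack `1` the query and later the answer, stack `2` the verdict. The
first program leaves its input intact, so it is still available when the answer is evaluated. By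
`hlen` the answer is no longer than the query, which keeps the evaluation polynomial. The
polynomials do not depend on the machine for `Q`. -/
theorem SolvableInTime.of_reduction {P Q : CompProblem} (φ : P.Inst → Q.Inst)
    (ψ : P.Inst → List Bool → Bool) (h₁ : Comp {P.encode} fun x => Q.encode (φ x))
    (h₂ : CompB {fun p : P.Inst × List Bool => P.encode p.1, fun p => (p.2.map some).reverse}
      fun p => ψ p.1 p.2)
    (hψ : ∀ x w, Q.Accepts (φ x) w → P.Accepts x [ψ x w])
    (hlen : ∀ y w, Q.Accepts y w → w.length ≤ Q.size y) :
    ∃ p q : Polynomial ℕ, (∀ x, Q.size (φ x) ≤ q.eval (P.size x)) ∧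
      ∀ T, Q.SolvableInTime T → P.SolvableInTime fun x => T (φ x) + p.eval (P.size x) := by
  classical
  obtain ⟨P₁, p₁, hp₁, hP₁⟩ := h₁
  obtain ⟨P₂, p₂, hp₂, hP₂⟩ := h₂
  have hq : ∀ x, Q.size (φ x) ≤ p₁.eval (P.size x) := fun x =>
    hp₁ x (P.size x) fun v hv => by rw [Set.mem_singleton_iff.1 hv]; rfl
  refine ⟨p₁ + p₁ + p₁ + (p₂.comp (Polynomial.X + p₁) + (2 * Polynomial.X + 1) + (2 * p₁ + 1)) + 3,
    p₁, hq, ?_⟩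
  rintro T ⟨M, hM⟩
  let A := P₁ (fun _ => 0) 1 2
  -- The two loops at the end remove the input and the answer, as the halting configuration
  -- requires.
  let B := seq (P₂ (fun v => if v = fun p => (p.2.map some).reverse then 1 else 0) 2 3)
    (seq (loop 0 fun _ => skip) (loop 1 fun _ => skip))
  refine ⟨callComputable M A B (max 2 (max A.bound B.bound)), fun x => ?_⟩
  obtain ⟨w, hw, hMw⟩ := hM (φ x)
  refine ⟨[ψ x w], hψ x w hw, ?_⟩
  have hwl := (hlen _ _ hw).trans (hq x)
  let st : Store := Function.update (fun _ => []) 0 (P.encode x)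
  obtain ⟨t₁, ht₁, r₁⟩ := hP₁ (fun _ => 0) 1 2 x st (P.size x) (fun v hv => by
    rw [Set.mem_singleton_iff.1 hv]
    exact ⟨by omega, by omega, by simp [st], le_rfl⟩) (by omega)
    (fun i hi => by simp only [st]; rw [Function.update_of_ne (by omega)])
  obtain ⟨t₂, ht₂, r₂⟩ := hP₂ (fun v => if v = fun p => (p.2.map some).reverse then 1 else 0) 2 3
    (x, w) (Function.update st 1 (w.map some).reverse) (P.size x + p₁.eval (P.size x))
    (fun v hv => by
      by_cases h : v = fun p => (p.2.map some).reverse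
      · rw [if_pos h]
        subst h
        exact ⟨by omega, by omega, by simp, by simp; omega⟩
      · rw [if_neg h]
        have hv' := hv.resolve_right h
        subst hv'
        exact ⟨by omega, by omega, by simp [st], Nat.le_add_right _ _⟩) (by omega)
    (fun i hi => by
      simp only [st]
      rw [Function.update_of_ne (by omega), Function.update_of_ne (by omega)])
  have r₃ := r₂.seq ((run_clear (i := 0) (P.encode x) _ (by simp [st])).seq
    (run_clear (i := 1) (w.map some).reverse _ (by simp)))
  have r₁' : A.Run (Function.update (fun _ => []) 0 (P.encode x)) t₁
      (Function.update st 1 (Q.encode (φ x)).reverse) := by simpa [st] using r₁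
  have e : Function.update (Function.update (Function.update (Function.update st 1
      (w.map some).reverse) 2 ([some (ψ x w)].reverse ++
        Function.update st 1 (w.map some).reverse 2)) 0 []) 1 [] =
      (Function.update (fun _ => []) 2 [some (ψ x w)] : Store) := by
    clear * -
    funext i
    by_cases h₀ : i = 0
    · simp [h₀]
    by_cases h₁ : i = 1
    · simp [h₁]
    by_cases h₂ : i = 2
    · simp [h₂, st]
    · simp [h₀, h₁, h₂, st]
  have r₃' : B.Run (Function.update st 1 (w.map some).reverse) _
      (Function.update (fun _ => []) 2 [some (ψ x w)]) := e ▸ r₃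
  obtain ⟨⟨e, he⟩⟩ := outputsInTime_callComputable (M := M) (le_max_left 2 (max A.bound B.bound))
    ((le_max_left _ _).trans (le_max_right _ _)) ((le_max_right _ _).trans (le_max_right _ _))
    r₁' hMw r₃'
  refine ⟨⟨e, he.trans ?_⟩⟩
  have hq' : (Q.encode (φ x)).length ≤ p₁.eval (P.size x) := hq x
  have hP : (P.encode x).length = P.size x := rfl
  simp only [Polynomial.eval_add, Polynomial.eval_comp, Polynomial.eval_mul, Polynomial.eval_X,
    Polynomial.eval_ofNat, Polynomial.eval_one, List.length_reverse, List.length_map]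
  omega

end CompProblem

theorem length_encodeVertexSet_le {n : ℕ} (S : Finset (Fin n)) (G : SimpleGraph (Fin n)) :
    (encodeVertexSet S).length ≤ (encodeGraph G).length := by
  simp [encodeVertexSet, encodeGraph, List.length_flatMap]
  nlinarith

theorem exists_gapDkS_reduction {rho : ℝ} (h : rho < 3 / 2) :
    ∃ lam : ℝ, 1 ≤ lam ∧ ∃ (r : ℕ) (φ : DkSInstance → DALkSInstance) (p q : Polynomial ℕ),
      (∀ x, (φ x).k < r ^ 2 * x.k * (x.k * x.k) + 2) ∧
      (∀ x, (ApproxDALkS rho).size (φ x) ≤ q.eval ((GapDkS lam).size x)) ∧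
      ∀ T, (ApproxDALkS rho).SolvableInTime T →
        (GapDkS lam).SolvableInTime fun x => T (φ x) + p.eval ((GapDkS lam).size x) := by
  -- The constant is chosen for `max rho 0`, since `rho` is negative when `ε` is large.
  obtain ⟨r, hr, hr'⟩ := exists_reduction_constant (max_lt h (by norm_num : (0 : ℝ) < 3 / 2))
  have hlam : 1 ≤ 72 * r ^ 9 := Nat.succ_le_of_lt (by positivity)
  obtain ⟨p, q, hq, hT⟩ := CompProblem.SolvableInTime.of_reduction
    (P := GapDkS (72 * r ^ 9 : ℕ)) (Q := ApproxDALkS rho) (reduction r hr) (verdict r)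
    (Comp.reductionWord r hr (x := fun x => x) (Comp.var rfl))
    (CompB.verdict r (x := Prod.fst) (w := Prod.snd) (Comp.var (Or.inl rfl))
      ((Comp.var (Or.inr rfl)).reverse.congr fun p => List.reverse_reverse _))
    (fun x w hw => ⟨_, rfl, fun hl => verdict_eq_true hr hl (le_max_left _ _) (le_max_right _ _) hr' hw,
      fun hl => verdict_eq_false hr hl⟩)
    (by
      rintro y w ⟨S, rfl, -⟩
      refine (length_encodeVertexSet_le S y.G).trans ?_
      show _ ≤ (encodeNumber y.k ++ encodeGraph y.G).length
      rw [List.length_append]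
      exact Nat.le_add_left _ _)
  exact ⟨_, by exact_mod_cast hlam, r, reduction r hr, p, q, param_reduction_lt hr, hq, hT⟩

end

theorem theorem1 :
    ((∀ lam : ℝ, 1 ≤ lam → ¬ (GapDkS lam).PolyTimeSolvable) →
      ∀ ε : ℝ, 0 < ε → ¬ (ApproxDALkS (3 / 2 - ε)).PolyTimeSolvable) ∧
    ((∀ lam : ℝ, 1 ≤ lam → ∀ f : ℕ → ℕ, ¬ (GapDkS lam).FPTSolvable f) →
      ∀ ε : ℝ, 0 < ε → ∀ f : ℕ → ℕ, ¬ (ApproxDALkS (3 / 2 - ε)).FPTSolvable f) := by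
  refine ⟨fun h ε hε => ?_, fun h ε hε f => ?_⟩
  · rintro ⟨s, hs⟩
    obtain ⟨lam, hlam, r, φ, p, q, -, hq, hT⟩ :=
      exists_gapDkS_reduction (by linarith : 3 / 2 - ε < 3 / 2)
    refine h lam hlam ⟨s.comp q + p, (hT _ hs).mono fun x => ?_⟩
    rw [Polynomial.eval_add, Polynomial.eval_comp]
    exact Nat.add_le_add_right (s.eval_le_eval_nat (hq x)) _
  · rintro ⟨s, hs⟩
    obtain ⟨lam, hlam, r, φ, p, q, hk, hq, hT⟩ :=
      exists_gapDkS_reduction (by linarith : 3 / 2 - ε < 3 / 2)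
    -- As `f` need not be monotone, its maximum over all possible new parameters is taken; adding 1
    -- makes the factor positive, so that it absorbs the additive term `p`.
    refine h lam hlam (fun k => (Finset.range (r ^ 2 * k * (k * k) + 2)).sup f + 1)
      ⟨s.comp q + p, (hT _ hs).mono fun x => ?_⟩
    rw [Polynomial.eval_add, Polynomial.eval_comp, mul_add]
    refine add_le_add (Nat.mul_le_mul ?_ (s.eval_le_eval_nat (hq x)))
      (Nat.le_mul_of_pos_left _ (Nat.succ_pos _))
    exact (Finset.le_sup (f := f) (Finset.mem_range.2 (hk x))).trans (Nat.le_succ _)
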